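/- Fix a conditional prefix machine $U$, i.e. a partial computable function $(p,y)\mapsto U_y(p)$ on binary strings such that for each $y$ the set of $p$ with $U_y(p)$ defined is prefix-free, and suppose $U$ is universal: for every conditional prefix machine $V$ there is a constant $c_V$ with $\mathbf K_U(x/y)\le \mathbf K_V(x/y)+c_V$ for all strings $x,y$, where $\mathbf K_U(x/y)=\min\{\|p\|:U_y(p)=x\}$. Put $\mathbf m(x/y)=\sum_{p:\,U_y(p)=x}2^{-\|p\|}$. A vector or matrix is called elementary if the real and imaginary parts of its entries are rational; elementary objects, natural numbers and tuples of such are encoded by binary strings in a fixed effective way. A semi-density matrix on $n$ qubits is a positive semidefinite complex $2^n\times 2^n$ matrix of trace at most $1$. For a string $x$ let $$\boldsymbol\mu_{n/x}=\sum_{\text{elementary unit vectors }|\phi\rangle\in\mathbb C^{2^n}}\mathbf m(|\phi\rangle/x,n)\,|\phi\rangle\langle\phi| ,$$ and for a semi-density matrix $\sigma$ on $n$ qubits let $\mathbf H(\sigma/x)=\lceil-\log_2\operatorname{Tr}\boldsymbol\mu_{n/x}\sigma\rceil\in\mathbb N\cup\{\infty\}$ (with value $\infty$ if the trace is $0$)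 be its Gács algorithmic entropy; $\mathbf H(\sigma)$ is $\mathbf H(\sigma/x)$ for empty $x$. **Theorem (Addition Inequality).** There is a constant $c$, depending only on $U$, such that for every $n$ and all semi-density matrices $\sigma,\rho$ on $n$ qubits with $\rho$ elementary, $$\mathbf H(\rho)+\mathbf H(\sigma/\langle\rho,\mathbf H(\rho)\rangle)\le \mathbf H(\sigma\otimes\rho)+c ,$$ where $\sigma\otimes\rho$ is regarded as a matrix on $2n$ qubits and $\langle\rho,\mathbf H(\rho)\rangle$ is the string encoding the pair of $\rho$ and the natural number $\mathbf H(\rho)$ (if $\rho=0$, where $\mathbf H(\rho)=\infty$, any fixed natural number may stand for $\mathbf H(\rho)$, and the inequality reads $\infty\le\infty$). -/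

import Mathlib

open scoped Kronecker ComplexOrder

noncomputable section

namespace QAlg

/-! ## Prefix machines, Kolmogorov complexity, universal probability -/

/-- A conditional prefix machine: a partial computable function of a program `p` and an auxiliary
string `y` such that, for every fixed `y`, the set of halting programs is prefix-free. -/
structure PrefixMachine where
  run : List Bool → List Bool →. List Bool
  partrec : Partrec fun a : List Bool × List Bool => run a.1 a.2
  prefixFree : ∀ y p q, (run p y).Dom → (run q y).Dom → p <+: q → p = q

/-- `K_U(x/y)`: the least length of a program computing `x` from `y` (`⊤` if there is none). -/
def PrefixMachine.K (U : PrefixMachine) (x y : List Bool) : ℕ∞ :=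
  ⨅ (p : List Bool) (_ : x ∈ U.run p y), (p.length : ℕ∞)

/-- `U` is universal: it minimizes conditional prefix complexity, up to an additive constant, among
all conditional prefix machines. -/
def PrefixMachine.IsUniversal (U : PrefixMachine) : Prop :=
  ∀ V : PrefixMachine, ∃ c : ℕ, ∀ x y : List Bool, U.K x y ≤ V.K x y + c

/-- `m_U(x/y) = ∑ 2^{-‖p‖}` over the programs `p` with `U_y(p) = x` (a convergent series, by
Kraft's inequality). -/
def PrefixMachine.m (U : PrefixMachine) (x y : List Bool) : ℝ :=
  ∑' p : {p : List Bool // x ∈ U.run p y}, (1 / 2 : ℝ) ^ p.1.length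

/-- The string that encodes an object: the binary digits of its number under Mathlib's primitive
recursive numbering. The map is computable and injective. -/
def str {α : Type} [Primcodable α] (a : α) : List Bool :=
  Nat.bits (Encodable.encode a)

/-! ## Elementary objects -/

/-- Gaussian rationals `a + b i`, given by their real and imaginary parts. -/
abbrev GRat : Type := ℚ × ℚ

/-- The complex number with the given rational real and imaginary parts. -/
def GRat.toComplex (z : GRat) : ℂ := ⟨(z.1 : ℝ), (z.2 : ℝ)⟩

/-- Integer data of a Gaussian rational: numerators and denominators of its two parts. -/
def GRat.code (z : GRat) : (ℤ × ℕ) × (ℤ × ℕ) := ((z.1.num, z.1.den), (z.2.num, z.2.den))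

/-- Matrices on the space `Q_n` of `n` qubits, with `Q_n` identified with `ℂ^(2^n)`. -/
abbrev QMatrix (n : ℕ) : Type := Matrix (Fin (2 ^ n)) (Fin (2 ^ n)) ℂ

/-- Elementary matrices on `n` qubits, given by their Gaussian rational entries. -/
abbrev ElemMatrix (n : ℕ) : Type := Matrix (Fin (2 ^ n)) (Fin (2 ^ n)) GRat

/-- The complex matrix of an elementary matrix. -/
def ElemMatrix.toQ {n : ℕ} (ρ : ElemMatrix n) : QMatrix n := ρ.map GRat.toComplex

/-- The list of rows of an elementary matrix, as integer data. -/
def ElemMatrix.code {n : ℕ} (ρ : ElemMatrix n) : List (List ((ℤ × ℕ) × (ℤ × ℕ))) :=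
  List.ofFn fun i => List.ofFn fun j => (ρ i j).code

/-- Elementary pure states on `n` qubits: unit vectors with Gaussian rational coordinates. -/
def ElemState (n : ℕ) : Type :=
  {v : Fin (2 ^ n) → GRat // ∑ i, ((v i).1 ^ 2 + (v i).2 ^ 2) = 1}

/-- The complex vector `|φ⟩`. -/
def ElemState.vec {n : ℕ} (φ : ElemState n) : Fin (2 ^ n) → ℂ := fun i => (φ.1 i).toComplex

/-- The projection `|φ⟩⟨φ|`. -/
def ElemState.proj {n : ℕ} (φ : ElemState n) : QMatrix n :=
  Matrix.vecMulVec φ.vec (star φ.vec)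

/-- The list of coordinates of an elementary state, as integer data. -/
def ElemState.code {n : ℕ} (φ : ElemState n) : List ((ℤ × ℕ) × (ℤ × ℕ)) :=
  List.ofFn fun i => (φ.1 i).code

/-! ## Semi-density matrices and Gács entropy -/

/-- Semi-density matrices: positive semidefinite (hence with non-negative real trace), trace at
most one. -/
def IsSemiDensity {n : ℕ} (σ : QMatrix n) : Prop := σ.PosSemidef ∧ σ.trace.re ≤ 1

/-- The tensor product of operators on `n` and `k` qubits, as an operator on `n + k` qubits: the
Kronecker product with the row-major identification `(i, j) ↦ 2^k i + j` of the indices. -/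
def tensor {n k : ℕ} (A : QMatrix n) (B : QMatrix k) : QMatrix (n + k) :=
  let e : Fin (2 ^ n) × Fin (2 ^ k) ≃ Fin (2 ^ (n + k)) :=
    finProdFinEquiv.trans (finCongr (pow_add 2 n k).symm)
  Matrix.reindex e e (A ⊗ₖ B)

/-- The universal matrix `μ_{/x} = ∑ m(|φ⟩ / x, n) |φ⟩⟨φ|`, over all elementary pure states of `n`
qubits (an absolutely convergent series). -/
def universalMatrix (U : PrefixMachine) (n : ℕ) (x : List Bool) : QMatrix n :=
  ∑' φ : ElemState n, ((U.m (str φ.code) (str (x, n)) : ℝ) : ℂ) • φ.proj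

/-- Gács entropy `H(σ/x) = ⌈-log₂ Tr μ_{/x} σ⌉`, with value `⊤` if the trace is `0`. For
semi-density `σ` the trace is in `[0, 1]`, so that the natural-number ceiling is the ceiling. -/
def gacsEntropy (U : PrefixMachine) {n : ℕ} (σ : QMatrix n) (x : List Bool) : ℕ∞ :=
  if (universalMatrix U n x * σ).trace.re = 0 then ⊤
  else (⌈-Real.logb 2 (universalMatrix U n x * σ).trace.re⌉₊ : ℕ∞)

/-- The string `⟨ρ, H(ρ)⟩` (for `ρ = 0`, where `H(ρ) = ⊤`, the second entry is set to `0`). -/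
def entropyPair (U : PrefixMachine) {n : ℕ} (ρ : ElemMatrix n) : List Bool :=
  str (ρ.code, (gacsEntropy U ρ.toQ []).toNat)

end QAlg

end

open scoped Kronecker ComplexOrder ENNReal

noncomputable section

namespace QAlg

/-! ## Dyadic partial sums -/

/-! Write the trace of the universal matrix on 2n qubits against σ ⊗ ρ as a sum over programs p that
output a unit vector Φ. Each term is 2^{-|p|} Tr σW_Φ, where W_Φ ≥ 0 is the partial trace over the
second factor of |Φ⟩⟨Φ|(1 ⊗ ρ). The trace of W_Φ is the expectation of ρ in the second marginal of Φ
(`trace_weightedMarginal`). Hence Σ_p 2^{-|p|} Tr W_Φ is the expectation of ρ in the marginal of the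
universal matrix. That marginal is itself enumerable with trace at most 1, so the universal matrix
on n qubits dominates it (`PrefixMachine.IsUniversal.marginalSum_le`), and the sum is O(2^{-H(ρ)}).
Consequently 2^{H(ρ)} Σ_p 2^{-|p|} W_Φ is, up to a constant factor, a semi-density matrix that can
be enumerated from n, ρ and H(ρ). The universal matrix conditioned on ρ and H(ρ) dominates it too
(`PrefixMachine.IsUniversal.tensor_le`). Pairing with σ and taking logarithms gives the inequality.

Both dominations are instances of `PrefixMachine.IsUniversal.dominates`, which rests on two tools.
The first is the coding theorem (`PrefixMachine.IsUniversal.coding`): weights enumerated with total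
at most 1 are turned into a prefix machine in the manner of Kraft and Chaitin.

The second replaces a rational positive matrix M by elementary unit vectors. Eigenvectors and
normalized vectors are in general irrational, so M is only dominated, by a dyadic combination of
rational projections of total weight at most 4 Tr M (`exists_valid`). Symmetric Gaussian elimination
over the Gaussian rationals splits M into rational rank-one matrices, with the four-square theorem
absorbing the pivots. A rational vector v of arbitrary norm is then covered by two rational unit
vectors αv ± βu with u orthogonal to v. Such a decomposition carries a certificate made of rational
identities, so a machine finds one by exhaustive search. -/

theorem primrec_pow : Primrec₂ ((· ^ ·) : ℕ → ℕ → ℕ) :=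
  Primrec₂.unpaired'.1 Nat.Primrec.pow

/-- `∑_{i < s} 2^{-f i}` over the defined terms, as a pair of numerator and binary exponent. -/
def dyadicSum (f : ℕ → Option ℕ) (s : ℕ) : ℕ × ℕ :=
  Nat.rec (0, 0) (fun i a => (f i).elim a fun k => (a.1 * 2 ^ k + 2 ^ a.2, a.2 + k)) s

/-- `∑_{i < s} 2^{-f i}` over the defined terms. -/
def realSum (f : ℕ → Option ℕ) (s : ℕ) : ℝ :=
  ∑ i ∈ Finset.range s, (f i).elim 0 fun k => (1 / 2 : ℝ) ^ k

theorem dyadicSum_eq (f : ℕ → Option ℕ) (s : ℕ) :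
    ((dyadicSum f s).1 : ℝ) = realSum f s * 2 ^ (dyadicSum f s).2 := by
  induction s with
  | zero => simp [dyadicSum, realSum]
  | succ s ih =>
    have h1 : dyadicSum f (s + 1) = (f s).elim (dyadicSum f s) fun k =>
      ((dyadicSum f s).1 * 2 ^ k + 2 ^ (dyadicSum f s).2, (dyadicSum f s).2 + k) := rfl
    have h2 : realSum f (s + 1) = realSum f s + (f s).elim 0 fun k => (1 / 2 : ℝ) ^ k :=
      Finset.sum_range_succ _ _
    rw [h1, h2]
    cases hf : f s with
    | none => simpa using ih
    | some k =>
      simp only [Option.elim_some]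
      push_cast
      rw [ih, pow_add]
      have : (1 / 2 : ℝ) ^ k * 2 ^ k = 1 := by rw [← mul_pow]; norm_num
      linear_combination (-(2 : ℝ) ^ (dyadicSum f s).2) * this

theorem realSum_mono (f : ℕ → Option ℕ) : Monotone (realSum f) := by
  refine monotone_nat_of_le_succ fun s => ?_
  rw [realSum, realSum, Finset.sum_range_succ]
  have : 0 ≤ (f s).elim 0 fun k => (1 / 2 : ℝ) ^ k := by cases f s <;> simp
  linarith

theorem realSum_nonneg (f : ℕ → Option ℕ) (s : ℕ) : 0 ≤ realSum f s :=
  Finset.sum_nonneg fun i _ => by cases f i <;> simp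

theorem realSum_succ_of_some {f : ℕ → Option ℕ} {s k : ℕ} (h : f s = some k) :
    realSum f (s + 1) = realSum f s + (1 / 2) ^ k := by
  rw [realSum, realSum, Finset.sum_range_succ, h]; rfl

theorem primrec_dyadicSum {α : Type} [Primcodable α] {f : α → ℕ → Option ℕ} (hf : Primrec₂ f) :
    Primrec₂ fun a s => dyadicSum (f a) s := by
  refine Primrec.nat_rec (f := fun _ : α => ((0, 0) : ℕ × ℕ))
    (g := fun a (p : ℕ × ℕ × ℕ) => (f a p.1).elim p.2
      fun k => (p.2.1 * 2 ^ k + 2 ^ p.2.2, p.2.2 + k)) (Primrec.const _) ?_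
  have h : Primrec fun q : α × (ℕ × ℕ × ℕ) => Option.casesOn (motive := fun _ => ℕ × ℕ)
      (f q.1 q.2.1) q.2.2 fun k => (q.2.2.1 * 2 ^ k + 2 ^ q.2.2.2, q.2.2.2 + k) := by
    refine Primrec.option_casesOn (hf.comp Primrec.fst (Primrec.fst.comp Primrec.snd))
      (Primrec.snd.comp Primrec.snd) ?_
    have n : Primrec fun z : (α × (ℕ × ℕ × ℕ)) × ℕ => z.1.2.2.1 :=
      Primrec.fst.comp (Primrec.snd.comp (Primrec.snd.comp Primrec.fst))
    have m : Primrec fun z : (α × (ℕ × ℕ × ℕ)) × ℕ => z.1.2.2.2 :=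
      Primrec.snd.comp (Primrec.snd.comp (Primrec.snd.comp Primrec.fst))
    exact Primrec.pair (Primrec.nat_add.comp
      (Primrec.nat_mul.comp n (primrec_pow.comp (Primrec.const 2) Primrec.snd))
      (primrec_pow.comp (Primrec.const 2) m)) (Primrec.nat_add.comp m Primrec.snd)
  refine h.of_eq fun q => ?_
  show _ = (f q.1 q.2.1).elim _ _
  cases f q.1 q.2.1 <;> rfl

/-! ## Binary values -/

/-- The number with the given binary digits, most significant digit first. -/
def bitVal (p : List Bool) : ℕ := p.foldl (fun a b => 2 * a + b.toNat) 0

theorem foldl_bits (p : List Bool) (a : ℕ) :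
    p.foldl (fun a b => 2 * a + b.toNat) a = a * 2 ^ p.length + bitVal p := by
  induction p generalizing a with
  | nil => simp [bitVal]
  | cons b p ih =>
    rw [bitVal, List.foldl_cons, List.foldl_cons, ih, ih (2 * 0 + b.toNat), List.length_cons,
      pow_succ]
    ring

theorem bitVal_append (p q : List Bool) :
    bitVal (p ++ q) = bitVal p * 2 ^ q.length + bitVal q := by
  rw [bitVal, List.foldl_append, foldl_bits]; rfl

theorem bitVal_lt (p : List Bool) : bitVal p < 2 ^ p.length := by
  induction p using List.reverseRecOn with
  | nil => simp [bitVal]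
  | append_singleton p b ih =>
    have h : bitVal [b] ≤ 1 := by cases b <;> simp [bitVal]
    rw [bitVal_append, List.length_append, List.length_singleton, pow_one, pow_succ]
    omega

theorem exists_bitVal_eq (k a : ℕ) (h : a < 2 ^ k) : ∃ p, p.length = k ∧ bitVal p = a := by
  induction k generalizing a with
  | zero => exact ⟨[], rfl, by simp at h; simp [h, bitVal]⟩
  | succ k ih =>
    obtain ⟨p, hp, hv⟩ := ih (a / 2) (by rw [pow_succ] at h; omega)
    refine ⟨p ++ [a % 2 == 1], by simp [hp], ?_⟩
    rw [bitVal_append, hv]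
    rcases Nat.mod_two_eq_zero_or_one a with h2 | h2 <;> simp [h2, bitVal] <;> omega

theorem primrec_bitVal : Primrec bitVal := by
  refine Primrec.list_foldl (h := fun _ (p : ℕ × Bool) => 2 * p.1 + p.2.toNat)
    Primrec.id (Primrec.const 0) ?_
  exact Primrec.nat_add.comp
    (Primrec.nat_mul.comp (Primrec.const 2) (Primrec.fst.comp Primrec.snd))
    ((Primrec.dom_bool Bool.toNat).comp (Primrec.snd.comp Primrec.snd))

/-! ## Laying out requests as disjoint dyadic intervals -/

/-- The exponents requested by an enumeration. -/
def exps (e : ℕ → Option (List Bool × ℕ)) (s : ℕ) : Option ℕ := (e s).map Prod.snd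

/-- The string requested at stage `s`, provided that `p` names the dyadic interval of half the
requested length that is laid out at that stage. -/
def layout (e : ℕ → Option (List Bool × ℕ)) (p : List Bool) (s : ℕ) : Option (List Bool) :=
  (e s).bind fun r =>
    if p.length = r.2 + 1 ∧
        (dyadicSum (exps e) s).1 * 2 ^ (r.2 + 1) ≤ bitVal p * 2 ^ (dyadicSum (exps e) s).2 ∧
        bitVal p * 2 ^ (dyadicSum (exps e) s).2 <
          (dyadicSum (exps e) s).1 * 2 ^ (r.2 + 1) + 2 ^ (dyadicSum (exps e) s).2
    then some r.1 else none

theorem primrec_layout {e : List Bool → ℕ → Option (List Bool × ℕ)} (he : Primrec₂ e) :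
    Primrec₂ fun (a : List Bool × List Bool) s => layout (e a.2) a.1 s := by
  have hd := primrec_dyadicSum (f := fun y => exps (e y))
    (Primrec.option_map he (Primrec.snd.comp Primrec.snd).to₂)
  refine Primrec.option_bind (he.comp (Primrec.snd.comp Primrec.fst) Primrec.snd) ?_
  have hn : Primrec fun z : ((List Bool × List Bool) × ℕ) × (List Bool × ℕ) =>
      dyadicSum (exps (e z.1.1.2)) z.1.2 :=
    hd.comp (Primrec.snd.comp (Primrec.fst.comp Primrec.fst)) (Primrec.snd.comp Primrec.fst)
  have hk : Primrec fun z : ((List Bool × List Bool) × ℕ) × (List Bool × ℕ) => z.2.2 + 1 :=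
    Primrec.succ.comp (Primrec.snd.comp Primrec.snd)
  have hp : Primrec fun z : ((List Bool × List Bool) × ℕ) × (List Bool × ℕ) => z.1.1.1 :=
    Primrec.fst.comp (Primrec.fst.comp Primrec.fst)
  have hexp : Primrec fun z : ((List Bool × List Bool) × ℕ) × (List Bool × ℕ) =>
      2 ^ (dyadicSum (exps (e z.1.1.2)) z.1.2).2 :=
    primrec_pow.comp (Primrec.const 2) (Primrec.snd.comp hn)
  have hl := Primrec.nat_mul.comp (Primrec.fst.comp hn) (primrec_pow.comp (Primrec.const 2) hk)
  have hr := Primrec.nat_mul.comp (primrec_bitVal.comp hp) hexp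
  refine Primrec.ite ?_ (Primrec.option_some.comp (Primrec.fst.comp Primrec.snd))
    (Primrec.const none)
  exact (Primrec.eq.comp (Primrec.list_length.comp hp) hk).and
    ((Primrec.nat_le.comp hl hr).and (Primrec.nat_lt.comp hr (Primrec.nat_add.comp hl hexp)))

/-- Stage s owns the interval from the s-th partial sum to the next, which is two units long at
scale 2^{-(k+1)}. Rounding its left end up to a multiple of the unit loses less than one unit, so
the whole cylinder of `p` fits inside. Halving the requested length pays for this alignment. -/
theorem mem_layout {e : ℕ → Option (List Bool × ℕ)} {p x : List Bool} {s : ℕ}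
    (h : x ∈ layout e p s) : ∃ k, e s = some (x, k) ∧ p.length = k + 1 ∧
      realSum (exps e) s * 2 ^ (k + 1) ≤ bitVal p ∧
      (bitVal p + 1 : ℝ) < realSum (exps e) (s + 1) * 2 ^ (k + 1) := by
  rw [layout, Option.mem_def, Option.bind_eq_some_iff] at h
  obtain ⟨⟨x', k⟩, h1, h2⟩ := h
  split_ifs at h2 with h3
  obtain ⟨hl, ha, hb⟩ := h3
  simp only [Option.some.injEq] at h2
  subst h2
  refine ⟨k, h1, hl, ?_⟩
  rw [realSum_succ_of_some (k := k) (by simp [exps, h1])]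
  have hD := dyadicSum_eq (exps e) s
  generalize dyadicSum (exps e) s = D at *
  have hpos : (0 : ℝ) < 2 ^ D.2 := by positivity
  simp only at ha hb
  have ha' : ((D.1 * 2 ^ (k + 1) : ℕ) : ℝ) ≤ ((bitVal p * 2 ^ D.2 : ℕ) : ℝ) := by exact_mod_cast ha
  have hb' : ((bitVal p * 2 ^ D.2 : ℕ) : ℝ) < ((D.1 * 2 ^ (k + 1) + 2 ^ D.2 : ℕ) : ℝ) := by
    exact_mod_cast hb
  push_cast at ha' hb'
  rw [hD] at ha' hb'
  constructor
  · refine le_of_mul_le_mul_right ?_ hpos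
    linarith
  · have : (1 / 2 : ℝ) ^ k * 2 ^ (k + 1) = 2 := by
      rw [pow_succ, ← mul_assoc, ← mul_pow]; norm_num
    rw [add_mul, this]
    have h4 : (bitVal p : ℝ) < realSum (exps e) s * 2 ^ (k + 1) + 1 := by
      refine lt_of_mul_lt_mul_right ?_ hpos.le
      linarith
    linarith

/-- The cylinder of an extension `q` lies inside that of `p`, whereas different stages own disjoint
intervals. No bound on the total weight enters, so the machine built from `layout` is prefix-free
for every condition, including those whose requests sum to more than 1. -/
theorem layout_stage_unique {e : ℕ → Option (List Bool × ℕ)} {p q x x' : List Bool} {s s' : ℕ}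
    (h : x ∈ layout e p s) (h' : x' ∈ layout e q s') (hpq : p <+: q) : s = s' := by
  obtain ⟨k, -, hl, h1, h2⟩ := mem_layout h
  obtain ⟨k', -, hl', h1', h2'⟩ := mem_layout h'
  obtain ⟨r, rfl⟩ := hpq
  have hk : k' + 1 = k + 1 + r.length := by simp [hl] at hl'; omega
  rw [hk, pow_add, ← mul_assoc] at h1' h2'
  have hv := bitVal_append p r
  have hr := bitVal_lt r
  have hR : (0 : ℝ) < 2 ^ r.length := by positivity
  have hK : (0 : ℝ) < 2 ^ (k + 1) := by positivity
  have hlo : (bitVal p : ℝ) * 2 ^ r.length ≤ bitVal (p ++ r) := by rw [hv]; push_cast; simp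
  have hhi : (bitVal (p ++ r) : ℝ) + 1 ≤ (bitVal p + 1) * 2 ^ r.length := by
    have : bitVal (p ++ r) + 1 ≤ (bitVal p + 1) * 2 ^ r.length := by rw [hv, add_mul]; omega
    exact_mod_cast this
  by_contra hne
  rcases lt_or_gt_of_ne hne with hlt | hlt
  · have hm := realSum_mono (exps e) (Nat.succ_le_of_lt hlt)
    have h3 : (bitVal p : ℝ) + 1 < realSum (exps e) s' * 2 ^ (k + 1) :=
      h2.trans_le (mul_le_mul_of_nonneg_right hm hK.le)
    have := mul_lt_mul_of_pos_right h3 hR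
    linarith
  · have hm := realSum_mono (exps e) (Nat.succ_le_of_lt hlt)
    have h3 : realSum (exps e) (s' + 1) * 2 ^ (k + 1) ≤ bitVal p :=
      (mul_le_mul_of_nonneg_right hm hK.le).trans h1
    have := mul_le_mul_of_nonneg_right h3 hR.le
    linarith

/-- The program spells the left end of the interval, rounded up, in k + 1 binary digits. The bound
on the partial sums is what keeps this number below 2^{k+1}. -/
theorem exists_mem_layout {e : ℕ → Option (List Bool × ℕ)} (hle : ∀ s, realSum (exps e) s ≤ 1)
    {s k : ℕ} {x : List Bool} (hs : e s = some (x, k)) :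
    ∃ p, p.length = k + 1 ∧ x ∈ layout e p s := by
  obtain ⟨N, E⟩ : ∃ N, N = dyadicSum (exps e) s := ⟨_, rfl⟩
  have hD := dyadicSum_eq (exps e) s
  have h1 := hle (s + 1)
  rw [realSum_succ_of_some (k := k) (by simp [exps, hs])] at h1
  have hpos : (0 : ℝ) < 2 ^ N.2 := by positivity
  set a := ⌈realSum (exps e) s * 2 ^ (k + 1)⌉₊ with ha
  have hnn : 0 ≤ realSum (exps e) s * 2 ^ (k + 1) := mul_nonneg (realSum_nonneg _ _) (by positivity)
  have ha1 := Nat.le_ceil (realSum (exps e) s * 2 ^ (k + 1))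
  have ha2 := Nat.ceil_lt_add_one hnn
  rw [← ha] at ha1 ha2
  have h2 : (1 / 2 : ℝ) ^ k * 2 ^ (k + 1) = 2 := by
    rw [pow_succ, ← mul_assoc, ← mul_pow]; norm_num
  have h3 : (a : ℝ) < 2 ^ (k + 1) := by
    have := mul_le_mul_of_nonneg_right h1 (by positivity : (0 : ℝ) ≤ 2 ^ (k + 1))
    rw [add_mul, h2] at this
    linarith
  obtain ⟨p, hp, hv⟩ := exists_bitVal_eq (k + 1) a (by exact_mod_cast h3)
  refine ⟨p, hp, ?_⟩
  rw [layout, hs, Option.mem_def, Option.bind_some, if_pos]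
  rw [← E] at hD ⊢
  refine ⟨hp, ?_, ?_⟩
  · rw [hv]
    have : ((N.1 * 2 ^ (k + 1) : ℕ) : ℝ) ≤ ((a * 2 ^ N.2 : ℕ) : ℝ) := by
      push_cast; rw [hD]
      have := mul_le_mul_of_nonneg_right ha1 hpos.le
      linarith
    exact_mod_cast this
  · rw [hv]
    have : ((a * 2 ^ N.2 : ℕ) : ℝ) < ((N.1 * 2 ^ (k + 1) + 2 ^ N.2 : ℕ) : ℝ) := by
      push_cast; rw [hD]
      have := mul_lt_mul_of_pos_right ha2 hpos
      linarith
    exact_mod_cast this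

/-- The prefix machine that serves the requests of an enumeration. -/
def layoutMachine (e : List Bool → ℕ → Option (List Bool × ℕ)) (he : Primrec₂ e) :
    PrefixMachine where
  run p y := Nat.rfindOpt (layout (e y) p)
  partrec := Partrec.rfindOpt (primrec_layout he).to_comp
  prefixFree y p q hp hq hpq := by
    obtain ⟨s, x, hx⟩ := Nat.rfindOpt_dom.1 hp
    obtain ⟨s', x', hx'⟩ := Nat.rfindOpt_dom.1 hq
    obtain rfl := layout_stage_unique hx hx' hpq
    obtain ⟨k, h1, h2, -⟩ := mem_layout hx
    obtain ⟨k', h1', h2', -⟩ := mem_layout hx'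
    rw [h1] at h1'
    simp only [Option.some.injEq, Prod.mk.injEq] at h1'
    exact hpq.eq_of_length (by rw [h2, h2', h1'.2])

theorem exists_program_layoutMachine {e : List Bool → ℕ → Option (List Bool × ℕ)}
    (he : Primrec₂ e) {y : List Bool} (hle : ∀ s, realSum (exps (e y)) s ≤ 1)
    {s k : ℕ} {x : List Bool} (hs : e y s = some (x, k)) :
    ∃ p, p.length = k + 1 ∧ x ∈ (layoutMachine e he).run p y := by
  obtain ⟨p, hp, hx⟩ := exists_mem_layout hle hs
  refine ⟨p, hp, ?_⟩
  have hd : (Nat.rfindOpt (layout (e y) p)).Dom := Nat.rfindOpt_dom.2 ⟨s, x, hx⟩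
  have h1 := Part.get_mem hd
  obtain ⟨s', hs'⟩ := Nat.rfindOpt_spec h1
  -- The search may stop at another stage, but only one stage can answer to `p`.
  obtain rfl := layout_stage_unique hx hs' List.prefix_rfl
  rw [Option.mem_unique hx hs']
  exact h1

/-! ## From enumerated weights to requests -/

/-- `∑ 2^{-f i}` over the defined terms. -/
def weightSum (f : ℕ → Option ℕ) : ℝ≥0∞ := ∑' i, (f i).elim 0 fun k => (2⁻¹ : ℝ≥0∞) ^ k

theorem ofReal_half_pow (k : ℕ) : ENNReal.ofReal ((1 / 2 : ℝ) ^ k) = 2⁻¹ ^ k := by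
  rw [ENNReal.ofReal_pow (by norm_num), one_div, ENNReal.ofReal_inv_of_pos (by norm_num)]
  simp

theorem ofReal_realSum (f : ℕ → Option ℕ) (s : ℕ) : ENNReal.ofReal (realSum f s) =
    ∑ i ∈ Finset.range s, (f i).elim 0 fun k => (2⁻¹ : ℝ≥0∞) ^ k := by
  rw [realSum, ENNReal.ofReal_sum_of_nonneg]
  · refine Finset.sum_congr rfl fun i _ => ?_
    cases f i with
    | none => simp
    | some k => exact ofReal_half_pow k
  · intro i _
    cases f i <;> simp

theorem ofReal_realSum_le (f : ℕ → Option ℕ) (s : ℕ) :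
    ENNReal.ofReal (realSum f s) ≤ weightSum f := by
  rw [ofReal_realSum]; exact ENNReal.sum_le_tsum _

theorem realSum_le_one {f : ℕ → Option ℕ} (h : weightSum f ≤ 1) (s : ℕ) : realSum f s ≤ 1 :=
  ENNReal.ofReal_le_one.1 ((ofReal_realSum_le f s).trans h)

theorem weightSum_le {f : ℕ → Option ℕ} {C : ℝ≥0∞}
    (h : ∀ s, ENNReal.ofReal (realSum f s) ≤ C) : weightSum f ≤ C := by
  rw [weightSum, ENNReal.tsum_eq_iSup_nat]
  exact iSup_le fun s => (ofReal_realSum f s) ▸ h s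

/-- The exponents of the events concerning `x`. -/
def expsOf (e : ℕ → Option (List Bool × ℕ)) (x : List Bool) (s : ℕ) : Option ℕ :=
  (e s).bind fun r => if r.1 = x then some r.2 else none

theorem tsum_weightSum_expsOf (e : ℕ → Option (List Bool × ℕ)) :
    ∑' x, weightSum (expsOf e x) = weightSum (exps e) := by
  simp only [weightSum]
  rw [ENNReal.tsum_comm]
  refine tsum_congr fun s => ?_
  cases h : e s with
  | none => simp [expsOf, exps, h]
  | some r =>
    rw [tsum_eq_single r.1]
    · simp [expsOf, exps, h]
    · intro x hx
      simp [expsOf, h, hx.symm]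

/-- At stage `⟨s, j⟩`, request `x` with exponent `j + 1` if the weight enumerated for `x` reaches
`2^{-j}` with the event number `s`. -/
def crossing (e : ℕ → Option (List Bool × ℕ)) (n : ℕ) : Option (List Bool × ℕ) :=
  (e n.unpair.1).bind fun r =>
    if (dyadicSum (expsOf e r.1) n.unpair.1).1 * 2 ^ n.unpair.2 <
          2 ^ (dyadicSum (expsOf e r.1) n.unpair.1).2 ∧
        2 ^ (dyadicSum (expsOf e r.1) (n.unpair.1 + 1)).2 ≤
          (dyadicSum (expsOf e r.1) (n.unpair.1 + 1)).1 * 2 ^ n.unpair.2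
    then some (r.1, n.unpair.2 + 1) else none

theorem primrec_crossing {e : List Bool → ℕ → Option (List Bool × ℕ)} (he : Primrec₂ e) :
    Primrec₂ fun y n => crossing (e y) n := by
  have hx : Primrec₂ fun (a : List Bool × List Bool) s => expsOf (e a.1) a.2 s := by
    refine Primrec.option_bind (he.comp (Primrec.fst.comp Primrec.fst) Primrec.snd) ?_
    exact Primrec.ite (Primrec.eq.comp (Primrec.fst.comp Primrec.snd)
      (Primrec.snd.comp (Primrec.fst.comp Primrec.fst)))
      (Primrec.option_some.comp (Primrec.snd.comp Primrec.snd)) (Primrec.const none)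
  have hd := primrec_dyadicSum hx
  have hu : Primrec fun a : List Bool × ℕ => a.2.unpair := Primrec.unpair.comp Primrec.snd
  refine Primrec.option_bind (he.comp Primrec.fst (Primrec.fst.comp hu)) ?_
  have hs : Primrec fun z : (List Bool × ℕ) × (List Bool × ℕ) => z.1.2.unpair.1 :=
    Primrec.fst.comp (hu.comp Primrec.fst)
  have hj : Primrec fun z : (List Bool × ℕ) × (List Bool × ℕ) => z.1.2.unpair.2 :=
    Primrec.snd.comp (hu.comp Primrec.fst)
  have hyx : Primrec fun z : (List Bool × ℕ) × (List Bool × ℕ) => (z.1.1, z.2.1) :=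
    Primrec.pair (Primrec.fst.comp Primrec.fst) (Primrec.fst.comp Primrec.snd)
  have h1 := hd.comp hyx hs
  have h2 := hd.comp hyx (Primrec.succ.comp hs)
  have hpow := primrec_pow.comp (Primrec.const 2) hj
  refine Primrec.ite ?_ (Primrec.option_some.comp
    (Primrec.pair (Primrec.fst.comp Primrec.snd) (Primrec.succ.comp hj))) (Primrec.const none)
  exact (Primrec.nat_lt.comp (Primrec.nat_mul.comp (Primrec.fst.comp h1) hpow)
      (primrec_pow.comp (Primrec.const 2) (Primrec.snd.comp h1))).and
    (Primrec.nat_le.comp (primrec_pow.comp (Primrec.const 2) (Primrec.snd.comp h2))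
      (Primrec.nat_mul.comp (Primrec.fst.comp h2) hpow))

theorem dyadicSum_lt_iff (f : ℕ → Option ℕ) (s j : ℕ) :
    (dyadicSum f s).1 * 2 ^ j < 2 ^ (dyadicSum f s).2 ↔ realSum f s < (1 / 2) ^ j := by
  have h := dyadicSum_eq f s
  generalize dyadicSum f s = D at *
  have hpos : (0 : ℝ) < 2 ^ D.2 := by positivity
  have hj : (0 : ℝ) < 2 ^ j := by positivity
  have : D.1 * 2 ^ j < 2 ^ D.2 ↔ ((D.1 * 2 ^ j : ℕ) : ℝ) < ((2 ^ D.2 : ℕ) : ℝ) := by norm_cast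
  rw [this]
  push_cast
  rw [h, one_div, inv_pow, ← one_div, lt_div_iff₀ hj]
  constructor
  · intro h1
    refine lt_of_mul_lt_mul_right ?_ hpos.le
    linarith
  · intro h1
    have := mul_lt_mul_of_pos_right h1 hpos
    linarith

theorem crossing_eq_some_iff (e : ℕ → Option (List Bool × ℕ)) (s j i : ℕ) (x : List Bool) :
    crossing e (Nat.pair s j) = some (x, i) ↔ i = j + 1 ∧ (∃ k, e s = some (x, k)) ∧
      realSum (expsOf e x) s < (1 / 2) ^ j ∧ (1 / 2) ^ j ≤ realSum (expsOf e x) (s + 1) := by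
  rw [crossing, Option.bind_eq_some_iff]
  simp only [Nat.unpair_pair, ← not_lt (b := 2 ^ _), dyadicSum_lt_iff]
  constructor
  · rintro ⟨⟨x', k⟩, h1, h2⟩
    split_ifs at h2 with h3
    simp only [Option.some.injEq, Prod.mk.injEq] at h2
    obtain ⟨rfl, rfl⟩ := h2
    exact ⟨rfl, ⟨k, h1⟩, h3.1, not_lt.1 h3.2⟩
  · rintro ⟨rfl, ⟨k, hk⟩, h⟩
    exact ⟨(x, k), hk, by rw [if_pos ⟨h.1, not_lt.2 h.2⟩]⟩

/-- If j₀ is the first level below T, the terms from j₀ on form a geometric series with sum 2^{-j₀}.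
The shift of the exponent by one makes the levels together cost no more than T. -/
theorem tsum_half_pow_succ_le (T : ℝ≥0∞) :
    ∑' j : ℕ, (if (2⁻¹ : ℝ≥0∞) ^ j ≤ T then (2⁻¹ : ℝ≥0∞) ^ (j + 1) else 0) ≤ T := by
  by_cases h : ∃ j : ℕ, (2⁻¹ : ℝ≥0∞) ^ j ≤ T
  · classical
    obtain ⟨j₀, hj₀, hmin⟩ : ∃ j₀ : ℕ, (2⁻¹ : ℝ≥0∞) ^ j₀ ≤ T ∧ ∀ j < j₀, ¬ (2⁻¹ : ℝ≥0∞) ^ j ≤ T :=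
      ⟨Nat.find h, Nat.find_spec h, fun j hj => Nat.find_min h hj⟩
    refine le_trans ?_ hj₀
    rw [← Summable.sum_add_tsum_nat_add' (k := j₀) ENNReal.summable, Finset.sum_eq_zero, zero_add]
    · calc _ ≤ ∑' i : ℕ, (2⁻¹ : ℝ≥0∞) ^ (j₀ + 1) * 2⁻¹ ^ i := by
            refine ENNReal.tsum_le_tsum fun i => ?_
            split_ifs
            · rw [← pow_add]; apply le_of_eq; congr 1; omega
            · exact zero_le
        _ = _ := by
            rw [ENNReal.tsum_mul_left, ENNReal.tsum_geometric, ENNReal.one_sub_inv_two, inv_inv,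
              pow_succ, mul_assoc, ENNReal.inv_mul_cancel (by simp) (by simp), mul_one]
    · intro i hi
      rw [if_neg (hmin i (Finset.mem_range.1 hi))]
  · push Not at h
    rw [ENNReal.tsum_eq_zero.2]
    · exact zero_le
    · intro j; rw [if_neg (h j).not_ge]

/-- Partial sums increase, so each level 2^{-j} is crossed by at most one event for each `x`, and
only if it lies below the total weight of `x`. Summing over levels and then over `x` gives the
bound. -/
theorem weightSum_crossing_le (e : ℕ → Option (List Bool × ℕ)) :
    weightSum (exps (crossing e)) ≤ weightSum (exps e) := by
  classical
  let c : List Bool → ℕ → ℕ → Prop := fun x j s => crossing e (Nat.pair s j) = some (x, j + 1)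
  have h1 : weightSum (exps (crossing e)) =
      ∑' x, ∑' j, ∑' s, if c x j s then (2⁻¹ : ℝ≥0∞) ^ (j + 1) else 0 := by
    rw [weightSum, ← Nat.pairEquiv.tsum_eq, ENNReal.tsum_prod', ENNReal.tsum_comm]
    rw [ENNReal.tsum_comm (α := List Bool)]
    refine tsum_congr fun j => ?_
    rw [ENNReal.tsum_comm]
    refine tsum_congr fun s => ?_
    simp only [Nat.pairEquiv_apply, Function.uncurry_apply_pair, exps]
    rcases Option.eq_none_or_eq_some (crossing e (Nat.pair s j)) with h | ⟨⟨x, i⟩, h⟩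
    · simp [c, h]
    · obtain ⟨rfl, -⟩ := (crossing_eq_some_iff e s j i x).1 h
      rw [tsum_eq_single x]
      · simp [c, h]
      · intro x' hx
        simp [c, h, hx.symm]
  rw [h1, ← tsum_weightSum_expsOf]
  refine ENNReal.tsum_le_tsum fun x => ?_
  refine le_trans (ENNReal.tsum_le_tsum fun j => ?_) (tsum_half_pow_succ_le _)
  by_cases hex : ∃ s, c x j s
  · obtain ⟨s, hs⟩ := hex
    obtain ⟨-, -, hs1, hs2⟩ := (crossing_eq_some_iff e s j _ x).1 hs
    rw [tsum_eq_single s]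
    · rw [if_pos hs, if_pos]
      rw [← ofReal_half_pow]
      exact (ENNReal.ofReal_le_ofReal hs2).trans (ofReal_realSum_le _ _)
    · intro s' hne
      refine if_neg fun hs' => ?_
      obtain ⟨-, -, hs1', hs2'⟩ := (crossing_eq_some_iff e s' j _ x).1 hs'
      rcases lt_or_gt_of_ne hne with h | h
      · exact absurd (hs2'.trans (realSum_mono _ h)) hs1.not_ge
      · exact absurd (hs2.trans (realSum_mono _ h)) hs1'.not_ge
  · push Not at hex
    rw [ENNReal.tsum_eq_zero.2]
    · exact zero_le
    · intro s; rw [if_neg (hex s)]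

/-- A machine serves single requests, while the weight of `x` may be spread over many small events.
Taking the largest power of 1/2 strictly below the accumulated weight, and the first event at which
it is reached, yields one request that represents this weight within a constant factor. -/
theorem exists_crossing {e : ℕ → Option (List Bool × ℕ)} {x : List Bool} {s : ℕ}
    (hpos : 0 < realSum (expsOf e x) s) (hle : realSum (expsOf e x) s ≤ 1) :
    ∃ n j, crossing e n = some (x, j + 1) ∧ realSum (expsOf e x) s ≤ 2 * (1 / 2) ^ j := by
  classical
  obtain ⟨m, hm1, hm2⟩ := exists_nat_pow_near_of_lt_one hpos hle
    (by norm_num : (0 : ℝ) < 1 / 2) (by norm_num)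
  have hex : ∃ s, (1 / 2 : ℝ) ^ (m + 1) ≤ realSum (expsOf e x) s := ⟨s, hm1.le⟩
  obtain ⟨s₀, hs₀⟩ : ∃ s₀, Nat.find hex = s₀ + 1 := by
    refine Nat.exists_eq_succ_of_ne_zero fun h0 => ?_
    have := Nat.find_spec hex
    rw [h0] at this
    simp only [realSum, Finset.range_zero, Finset.sum_empty] at this
    exact absurd this (by positivity : (0 : ℝ) < (1 / 2) ^ (m + 1)).not_ge
  have h1 := Nat.find_spec hex
  have h2 : realSum (expsOf e x) s₀ < (1 / 2) ^ (m + 1) :=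
    not_le.1 (Nat.find_min hex (by omega))
  rw [hs₀] at h1
  have h3 : ∃ k, e s₀ = some (x, k) := by
    by_contra hno
    have hn : expsOf e x s₀ = none := by
      rw [expsOf, Option.bind_eq_none_iff]
      intro r hr
      rw [if_neg]
      rintro rfl
      exact hno ⟨r.2, hr⟩
    have : realSum (expsOf e x) (s₀ + 1) = realSum (expsOf e x) s₀ := by
      rw [realSum, Finset.sum_range_succ, hn]; simp [realSum]
    rw [this] at h1
    exact absurd h1 h2.not_ge
  refine ⟨Nat.pair s₀ (m + 1), m + 1, (crossing_eq_some_iff _ _ _ _ _).2 ⟨rfl, h3, h2, h1⟩, ?_⟩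
  rw [pow_succ]
  linarith

/-! ## Enumerating a family of partial values -/

open Classical in
/-- `F` of the value of a partial object, and `0` if there is none. -/
def partElim {β : Type} (o : Part β) (F : β → ℝ≥0∞) : ℝ≥0∞ := if h : o.Dom then F (o.get h) else 0

theorem partElim_of_mem {β : Type} {o : Part β} {b : β} (h : b ∈ o) (F : β → ℝ≥0∞) :
    partElim o F = F b := by
  rw [partElim, dif_pos (Part.dom_iff_mem.2 ⟨b, h⟩), Part.get_eq_of_mem h]

theorem partElim_of_not_dom {β : Type} {o : Part β} (h : ¬ o.Dom) (F : β → ℝ≥0∞) :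
    partElim o F = 0 := dif_neg h

/-- Stage ⟨t, m⟩ reports the value of `g y t` exactly when the computation halts within the bound m
+ 1 but not within m. Each defined value is thus reported once, which the equality of sums requires.
-/
theorem exists_enumeration {β : Type} [Primcodable β] {g : List Bool → ℕ →. β} (hg : Partrec₂ g) :
    ∃ e : List Bool → ℕ → Option β, Primrec₂ e ∧ ∀ y (F : β → ℝ≥0∞),
      ∑' n, (e y n).elim 0 F = ∑' t, partElim (g y t) F := by
  classical
  obtain ⟨c, hc⟩ := Nat.Partrec.Code.exists_code.1 hg
  have hev : ∀ y t, c.eval (Encodable.encode (y, t)) = (g y t).map Encodable.encode := by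
    intro y t; rw [hc]; simp
  let ev : List Bool → ℕ → ℕ → Option ℕ := fun y t m =>
    Nat.Partrec.Code.evaln m c (Encodable.encode (y, t))
  let e : List Bool → ℕ → Option β := fun y n =>
    if ev y n.unpair.1 n.unpair.2 = none then
      (ev y n.unpair.1 (n.unpair.2 + 1)).bind fun v => Encodable.decode v
    else none
  have hu : Primrec fun a : List Bool × ℕ => a.2.unpair := Primrec.unpair.comp Primrec.snd
  have hp : Primrec fun a : List Bool × ℕ => Encodable.encode (a.1, a.2.unpair.1) :=
    Primrec.encode.comp (Primrec.pair Primrec.fst (Primrec.fst.comp hu))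
  refine ⟨e, ?_, fun y F => ?_⟩
  · have hr : ∀ {f : List Bool × ℕ → ℕ}, Primrec f →
        Primrec fun a : List Bool × ℕ => ev a.1 a.2.unpair.1 (f a) := fun hf =>
      Nat.Partrec.Code.primrec_evaln.comp (Primrec.pair (Primrec.pair hf (Primrec.const c)) hp)
    refine Primrec.ite (Primrec.eq.comp (hr (Primrec.snd.comp hu)) (Primrec.const none)) ?_
      (Primrec.const none)
    exact Primrec.option_bind (hr (Primrec.succ.comp (Primrec.snd.comp hu)))
      (Primrec.decode.comp Primrec.snd)
  · rw [← Nat.pairEquiv.tsum_eq, ENNReal.tsum_prod']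
    refine tsum_congr fun t => ?_
    simp only [Nat.pairEquiv_apply, Function.uncurry_apply_pair]
    by_cases hd : (g y t).Dom
    · obtain ⟨b, hb⟩ := Part.dom_iff_mem.1 hd
      have hb' : Encodable.encode b ∈ c.eval (Encodable.encode (y, t)) := by
        rw [hev]; exact Part.mem_map _ hb
      have hex : ∃ m, ∃ v, ev y t m = some v := by
        obtain ⟨k, hk⟩ := Nat.Partrec.Code.evaln_complete.1 hb'
        exact ⟨k, _, hk⟩
      have hval : ∀ m v, ev y t m = some v → v = Encodable.encode b := fun m v h =>
        Part.mem_unique (Nat.Partrec.Code.evaln_sound h) hb'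
      obtain ⟨m₀, hm₀⟩ : ∃ m₀, Nat.find hex = m₀ + 1 := by
        refine Nat.exists_eq_succ_of_ne_zero fun h0 => ?_
        obtain ⟨v, hv⟩ := Nat.find_spec hex
        rw [h0] at hv
        simp [ev, Nat.Partrec.Code.evaln] at hv
      obtain ⟨v, hv⟩ := Nat.find_spec hex
      have hnone : ev y t m₀ = none :=
        Option.eq_none_iff_forall_ne_some.2 fun v h =>
          Nat.find_min hex (by omega : m₀ < Nat.find hex) ⟨v, h⟩
      rw [hm₀] at hv
      rw [tsum_eq_single m₀, partElim_of_mem hb]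
      · have : e y (Nat.pair t m₀) = some b := by
          simp [e, hnone, hv, hval _ _ hv]
        rw [this]; rfl
      · intro m hm
        have : e y (Nat.pair t m) = none := by
          simp only [e, Nat.unpair_pair, ite_eq_right_iff, Option.bind_eq_none_iff]
          intro h1 v' h2
          exfalso
          rcases lt_or_gt_of_ne hm with h | h
          · exact Nat.find_min hex (by omega : m + 1 < Nat.find hex) ⟨v', h2⟩
          · have := Nat.Partrec.Code.evaln_mono (by omega : m₀ + 1 ≤ m) hv
            change ev y t m = some v at this
            rw [h1] at this
            cases this
        rw [this]; rfl
    · rw [partElim_of_not_dom hd, ENNReal.tsum_eq_zero.2]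
      intro m
      have : e y (Nat.pair t m) = none := by
        simp only [e, Nat.unpair_pair, ite_eq_right_iff, Option.bind_eq_none_iff]
        intro h1 v' h2
        exfalso
        have := Nat.Partrec.Code.evaln_sound h2
        rw [hev] at this
        obtain ⟨b, hb, -⟩ := (Part.mem_map_iff _).1 this
        exact hd (Part.dom_iff_mem.2 ⟨b, hb⟩)
      rw [this]; rfl

/-! ## Kraft's inequality and the coding theorem -/

/-- A prefix-free set without the empty word is uniquely decodable, so the Kraft–McMillan inequality
applies. The empty word, being a prefix of everything, can only occur alone. -/
theorem sum_half_pow_le_one {S : Finset (List Bool)}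
    (hS : ∀ p ∈ S, ∀ q ∈ S, p <+: q → p = q) : ∑ p ∈ S, (1 / 2 : ℝ) ^ p.length ≤ 1 := by
  by_cases hnil : [] ∈ S
  · have : S = {[]} := by
      ext q
      simp only [Finset.mem_singleton]
      exact ⟨fun hq => (hS _ hnil _ hq List.nil_prefix).symm, fun h => h ▸ hnil⟩
    simp [this]
  · have hU : InformationTheory.UniquelyDecodable (S : Set (List Bool)) := by
      intro L₁
      induction L₁ with
      | nil =>
        intro L₂ _ h2 h
        cases L₂ with
        | nil => rfl
        | cons q L =>
          simp only [List.flatten_nil, List.flatten_cons] at h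
          have := (List.append_eq_nil_iff.1 h.symm).1
          exact absurd (this ▸ h2 q (by simp)) hnil
      | cons p L ih =>
        intro L₂ h1 h2 h
        cases L₂ with
        | nil =>
          simp only [List.flatten_nil, List.flatten_cons] at h
          have := (List.append_eq_nil_iff.1 h).1
          exact absurd (this ▸ h1 p (by simp)) hnil
        | cons q L' =>
          simp only [List.flatten_cons] at h
          have hpq : p = q := by
            rcases List.prefix_or_prefix_of_prefix (List.prefix_append p L.flatten)
              (h ▸ List.prefix_append q L'.flatten) with h3 | h3
            · exact hS _ (h1 p (by simp)) _ (h2 q (by simp)) h3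
            · exact (hS _ (h2 q (by simp)) _ (h1 p (by simp)) h3).symm
          subst hpq
          rw [ih L' (fun w hw => h1 w (by simp [hw])) (fun w hw => h2 w (by simp [hw]))
            (List.append_cancel_left h)]
    simpa using InformationTheory.kraft_mcmillan_inequality hU

open Classical in
/-- `m_U(x/y)` as an extended non-negative real. -/
def PrefixMachine.mE (U : PrefixMachine) (x y : List Bool) : ℝ≥0∞ :=
  ∑' p : List Bool, if x ∈ U.run p y then (2⁻¹ : ℝ≥0∞) ^ p.length else 0

theorem PrefixMachine.tsum_partElim_le_one (U : PrefixMachine) (y : List Bool) :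
    ∑' p : List Bool, partElim (U.run p y) (fun _ => (2⁻¹ : ℝ≥0∞) ^ p.length) ≤ 1 := by
  classical
  rw [ENNReal.tsum_eq_iSup_sum]
  refine iSup_le fun S => ?_
  have h1 : ∑ p ∈ S, partElim (U.run p y) (fun _ => (2⁻¹ : ℝ≥0∞) ^ p.length) =
      ∑ p ∈ S.filter fun p => (U.run p y).Dom, (2⁻¹ : ℝ≥0∞) ^ p.length := by
    rw [Finset.sum_filter]; rfl
  rw [h1]
  simp only [← ofReal_half_pow]
  rw [← ENNReal.ofReal_sum_of_nonneg fun _ _ => by positivity, ENNReal.ofReal_le_one]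
  refine sum_half_pow_le_one fun p hp q hq hpq => ?_
  exact U.prefixFree y p q (Finset.mem_filter.1 hp).2 (Finset.mem_filter.1 hq).2 hpq

/-- A program has at most one output, so a sum over outputs regroups as a sum over programs. -/
theorem PrefixMachine.tsum_mE_mul (U : PrefixMachine) (y : List Bool) (F : List Bool → ℝ≥0∞) :
    ∑' x, U.mE x y * F x =
      ∑' p : List Bool, partElim (U.run p y) (fun x => (2⁻¹ : ℝ≥0∞) ^ p.length * F x) := by
  classical
  simp only [mE, ← ENNReal.tsum_mul_right]
  rw [ENNReal.tsum_comm]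
  refine tsum_congr fun p => ?_
  by_cases hd : (U.run p y).Dom
  · obtain ⟨x, hx⟩ := Part.dom_iff_mem.1 hd
    rw [partElim_of_mem hx, tsum_eq_single x, if_pos hx]
    intro x' hne
    rw [if_neg fun h => hne (Part.mem_unique h hx), zero_mul]
  · rw [partElim_of_not_dom hd, ENNReal.tsum_eq_zero.2]
    intro x
    rw [if_neg fun h => hd (Part.dom_iff_mem.2 ⟨x, h⟩), zero_mul]

theorem PrefixMachine.tsum_mE_le_one (U : PrefixMachine) (y : List Bool) :
    ∑' x, U.mE x y ≤ 1 := by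
  have := U.tsum_mE_mul y fun _ => 1
  simp only [mul_one] at this
  exact this ▸ U.tsum_partElim_le_one y

theorem PrefixMachine.mE_le_one (U : PrefixMachine) (x y : List Bool) : U.mE x y ≤ 1 :=
  (ENNReal.le_tsum x).trans (U.tsum_mE_le_one y)

theorem PrefixMachine.m_eq_toReal (U : PrefixMachine) (x y : List Bool) :
    U.m x y = (U.mE x y).toReal := by
  classical
  have h1 : U.mE x y = ∑' p : {p : List Bool // x ∈ U.run p y}, (2⁻¹ : ℝ≥0∞) ^ p.1.length := by
    rw [mE]
    exact (tsum_subtype {p : List Bool | x ∈ U.run p y}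
      fun p => (2⁻¹ : ℝ≥0∞) ^ p.length).symm
  rw [h1, ENNReal.tsum_toReal_eq fun p => by simp]
  simp [m]

theorem PrefixMachine.m_nonneg (U : PrefixMachine) (x y : List Bool) : 0 ≤ U.m x y := by
  rw [m_eq_toReal]; exact ENNReal.toReal_nonneg

theorem PrefixMachine.ofReal_m (U : PrefixMachine) (x y : List Bool) :
    ENNReal.ofReal (U.m x y) = U.mE x y := by
  rw [m_eq_toReal, ENNReal.ofReal_toReal ((U.mE_le_one x y).trans_lt ENNReal.one_lt_top).ne]

theorem PrefixMachine.le_mE (U : PrefixMachine) {p x y : List Bool} (h : x ∈ U.run p y) :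
    (2⁻¹ : ℝ≥0∞) ^ p.length ≤ U.mE x y := by
  classical
  refine le_trans ?_ (ENNReal.le_tsum p)
  rw [if_pos h]

theorem PrefixMachine.K_le (V : PrefixMachine) {p x y : List Bool} (h : x ∈ V.run p y) :
    V.K x y ≤ p.length := iInf₂_le p h

theorem PrefixMachine.exists_program (U : PrefixMachine) {x y : List Bool} {k : ℕ}
    (h : U.K x y ≤ k) : ∃ p, x ∈ U.run p y ∧ p.length ≤ k := by
  by_contra! hno
  have : ((k + 1 : ℕ) : ℕ∞) ≤ U.K x y :=
    le_iInf₂ fun p hp => by exact_mod_cast hno p hp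
  have h2 : k + 1 ≤ k := by exact_mod_cast this.trans h
  omega

open Classical in
/-- The coding theorem: a universal machine dominates every computably enumerated semimeasure. -/
theorem PrefixMachine.IsUniversal.coding {U : PrefixMachine} (hU : U.IsUniversal)
    {g : List Bool → ℕ →. List Bool × ℕ} (hg : Partrec₂ g) :
    ∃ c : ℕ, ∀ y, ∑' t, partElim (g y t) (fun r => (2⁻¹ : ℝ≥0∞) ^ r.2) ≤ 1 → ∀ x,
      ∑' t, partElim (g y t) (fun r => if r.1 = x then (2⁻¹ : ℝ≥0∞) ^ r.2 else 0) ≤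
        2 ^ c * U.mE x y := by
  obtain ⟨e, he, hsum⟩ := exists_enumeration hg
  obtain ⟨c, hc⟩ := hU (layoutMachine _ (primrec_crossing he))
  -- A weight of at most 2 · 2^{-j} is served by a program of length j + 2, and by one of length at
  -- most j + 2 + c on `U`; the total loss is the factor 2^{c+3}.
  refine ⟨c + 3, fun y hy x => ?_⟩
  have hw : weightSum (exps (e y)) ≤ 1 := by
    refine le_trans (le_of_eq ?_) ((hsum y _).trans_le hy)
    refine tsum_congr fun s => ?_
    rw [exps]; cases e y s <;> rfl
  have hx : ∑' t, partElim (g y t) (fun r => if r.1 = x then (2⁻¹ : ℝ≥0∞) ^ r.2 else 0) =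
      weightSum (expsOf (e y) x) := by
    rw [← hsum]
    refine tsum_congr fun s => ?_
    rw [expsOf]
    cases e y s with
    | none => rfl
    | some r => by_cases hr : r.1 = x <;> simp [hr]
  have hwx : weightSum (expsOf (e y) x) ≤ 1 :=
    ((ENNReal.le_tsum x).trans (tsum_weightSum_expsOf (e y)).le).trans hw
  rw [hx]
  refine weightSum_le fun s => ?_
  rcases (realSum_nonneg (expsOf (e y) x) s).eq_or_lt with h0 | hpos
  · rw [← h0]; simp
  obtain ⟨n, j, hn, hle⟩ := exists_crossing hpos (realSum_le_one hwx s)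
  obtain ⟨p, hp, hpx⟩ := exists_program_layoutMachine (primrec_crossing he)
    (realSum_le_one ((weightSum_crossing_le (e y)).trans hw)) hn
  obtain ⟨q, hq, hql⟩ := U.exists_program (k := j + 2 + c) <| (hc x y).trans <| by
    have := (layoutMachine _ (primrec_crossing he)).K_le hpx
    rw [hp] at this
    push_cast
    gcongr
    exact_mod_cast this
  refine le_trans ?_ (mul_le_mul_right (U.le_mE hq) _)
  rw [← ofReal_half_pow]
  have h2 : (2 : ℝ≥0∞) ^ (c + 3) = ENNReal.ofReal (2 ^ (c + 3)) := by
    rw [ENNReal.ofReal_pow (by norm_num)]; simp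
  rw [h2, ← ENNReal.ofReal_mul (by positivity)]
  refine ENNReal.ofReal_le_ofReal (hle.trans ?_)
  have h3 : (1 / 2 : ℝ) ^ (j + 2 + c) ≤ (1 / 2) ^ q.length :=
    pow_le_pow_of_le_one (by norm_num) (by norm_num) hql
  refine le_trans (le_of_eq ?_) (mul_le_mul_of_nonneg_left h3 (by positivity))
  have h4 : (2 : ℝ) ^ c * (1 / 2) ^ c = 1 := by rw [← mul_pow]; norm_num
  rw [pow_add, pow_add, pow_add]
  linear_combination (-2 * (1 / 2 : ℝ) ^ j) * h4

/-! ## Composition rules for primitive recursive functions -/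

attribute [fun_prop] Primrec

section Rules

variable {α β γ δ : Type} [Primcodable α] [Primcodable β] [Primcodable γ] [Primcodable δ]

@[fun_prop] theorem primrec_id' : Primrec fun a : α => a := Primrec.id
@[fun_prop] theorem primrec_const' (b : β) : Primrec fun _ : α => b := Primrec.const b
@[fun_prop] theorem primrec_comp' {f : β → γ} {g : α → β} (hf : Primrec f) (hg : Primrec g) :
    Primrec fun a => f (g a) := hf.comp hg
@[fun_prop] theorem primrec_fst' {f : α → β × γ} (hf : Primrec f) : Primrec fun a => (f a).1 :=
  Primrec.fst.comp hf
@[fun_prop] theorem primrec_snd' {f : α → β × γ} (hf : Primrec f) : Primrec fun a => (f a).2 :=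
  Primrec.snd.comp hf
@[fun_prop] theorem primrec_mk' {f : α → β} {g : α → γ} (hf : Primrec f) (hg : Primrec g) :
    Primrec fun a => (f a, g a) := Primrec.pair hf hg
@[fun_prop] theorem primrec_add' {f g : α → ℕ} (hf : Primrec f) (hg : Primrec g) :
    Primrec fun a => f a + g a := Primrec.nat_add.comp hf hg
@[fun_prop] theorem primrec_mul' {f g : α → ℕ} (hf : Primrec f) (hg : Primrec g) :
    Primrec fun a => f a * g a := Primrec.nat_mul.comp hf hg
@[fun_prop] theorem primrec_sub' {f g : α → ℕ} (hf : Primrec f) (hg : Primrec g) :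
    Primrec fun a => f a - g a := Primrec.nat_sub.comp hf hg
@[fun_prop] theorem primrec_pow' {f g : α → ℕ} (hf : Primrec f) (hg : Primrec g) :
    Primrec fun a => f a ^ g a := primrec_pow.comp hf hg
@[fun_prop] theorem primrec_range' {f : α → ℕ} (hf : Primrec f) :
    Primrec fun a => List.range (f a) := Primrec.list_range.comp hf
@[fun_prop] theorem primrec_length' {f : α → List β} (hf : Primrec f) :
    Primrec fun a => (f a).length := Primrec.list_length.comp hf
@[fun_prop] theorem primrec_getD' {f : α → List β} {g : α → ℕ} {d : α → β} (hf : Primrec f)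
    (hg : Primrec g) (hd : Primrec d) :
    Primrec fun a => (f a).getD (g a) (d a) := by
  simp only [List.getD_eq_getElem?_getD]
  exact Primrec.option_getD.comp (Primrec.list_getElem?.comp hf hg) hd
@[fun_prop] theorem primrec_map' {f : α → List β} {g : α → β → γ} (hf : Primrec f)
    (hg : Primrec fun p : α × β => g p.1 p.2) : Primrec fun a => (f a).map (g a) :=
  Primrec.list_map hf hg

end Rules

/-! ## Arithmetic of Gaussian rationals, given by unreduced natural data -/

/-- Unreduced data `((a, b), (c, d), e)` of the number `((a - b) + (c - d) i) / (e + 1)`. -/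
abbrev GData : Type := ((ℕ × ℕ) × (ℕ × ℕ)) × ℕ

namespace GData

def val (x : GData) : ℂ :=
  (((x.1.1.1 : ℂ) - x.1.1.2) + ((x.1.2.1 : ℂ) - x.1.2.2) * Complex.I) / (x.2 + 1)

/-- Storing the denominator less one excludes zero; the product is then stored as de + d + e.
Splitting each part into a difference of naturals makes the operations polynomial over ℕ, so
primitive recursiveness follows by composition. -/
def add (x y : GData) : GData :=
  (((x.1.1.1 * (y.2 + 1) + y.1.1.1 * (x.2 + 1), x.1.1.2 * (y.2 + 1) + y.1.1.2 * (x.2 + 1)),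
    (x.1.2.1 * (y.2 + 1) + y.1.2.1 * (x.2 + 1), x.1.2.2 * (y.2 + 1) + y.1.2.2 * (x.2 + 1))),
    x.2 * y.2 + x.2 + y.2)

def mul (x y : GData) : GData :=
  (((x.1.1.1 * y.1.1.1 + x.1.1.2 * y.1.1.2 + x.1.2.1 * y.1.2.2 + x.1.2.2 * y.1.2.1,
      x.1.1.1 * y.1.1.2 + x.1.1.2 * y.1.1.1 + x.1.2.1 * y.1.2.1 + x.1.2.2 * y.1.2.2),
    (x.1.1.1 * y.1.2.1 + x.1.1.2 * y.1.2.2 + x.1.2.1 * y.1.1.1 + x.1.2.2 * y.1.1.2,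
      x.1.1.1 * y.1.2.2 + x.1.1.2 * y.1.2.1 + x.1.2.1 * y.1.1.2 + x.1.2.2 * y.1.1.1)),
    x.2 * y.2 + x.2 + y.2)

def conj (x : GData) : GData := ((x.1.1, (x.1.2.2, x.1.2.1)), x.2)

theorem den_ne_zero (e : ℕ) : ((e : ℂ) + 1) ≠ 0 := by exact_mod_cast Nat.succ_ne_zero e

theorem val_add (x y : GData) : (x.add y).val = x.val + y.val := by
  have hx := den_ne_zero x.2
  have hy := den_ne_zero y.2
  have h : ((x.2 * y.2 + x.2 + y.2 : ℕ) : ℂ) + 1 = (x.2 + 1) * (y.2 + 1) := by push_cast; ring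
  simp only [val, add]
  rw [h, div_add_div _ _ hx hy]
  push_cast
  congr 1
  ring

theorem val_mul (x y : GData) : (x.mul y).val = x.val * y.val := by
  have h : ((x.2 * y.2 + x.2 + y.2 : ℕ) : ℂ) + 1 = (x.2 + 1) * (y.2 + 1) := by push_cast; ring
  simp only [val, mul]
  rw [h, div_mul_div_comm]
  push_cast
  congr 1
  linear_combination (-((x.1.2.1 : ℂ) - x.1.2.2) * (y.1.2.1 - y.1.2.2)) * Complex.I_sq

theorem val_conj (x : GData) : x.conj.val = star x.val := by
  simp only [val, conj, Complex.star_def, map_div₀, map_add, map_sub, map_mul, Complex.conj_natCast,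
    Complex.conj_I, map_one]
  congr 1
  ring

/-- Equality of the values. -/
def Eqv (x y : GData) : Prop :=
  (x.1.1.1 * (y.2 + 1) + y.1.1.2 * (x.2 + 1) = y.1.1.1 * (x.2 + 1) + x.1.1.2 * (y.2 + 1)) ∧
  (x.1.2.1 * (y.2 + 1) + y.1.2.2 * (x.2 + 1) = y.1.2.1 * (x.2 + 1) + x.1.2.2 * (y.2 + 1))

theorem eqv_iff (x y : GData) : Eqv x y ↔ x.val = y.val := by
  have hx := den_ne_zero x.2
  have hy := den_ne_zero y.2
  rw [val, val, div_eq_div_iff hx hy, Complex.ext_iff, Eqv]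
  have e1 : ∀ a b : ℕ, a = b ↔ (a : ℝ) = b := fun a b => Nat.cast_inj.symm
  rw [e1, e1]
  simp
  constructor <;> rintro ⟨h1, h2⟩ <;> constructor <;> linarith

@[fun_prop] theorem primrec_add {α : Type} [Primcodable α] {f g : α → GData} (hf : Primrec f)
    (hg : Primrec g) : Primrec fun a => (f a).add (g a) := by
  unfold add; fun_prop

@[fun_prop] theorem primrec_mul {α : Type} [Primcodable α] {f g : α → GData} (hf : Primrec f)
    (hg : Primrec g) : Primrec fun a => (f a).mul (g a) := by
  unfold mul; fun_prop

@[fun_prop] theorem primrec_conj {α : Type} [Primcodable α] {f : α → GData} (hf : Primrec f) :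
    Primrec fun a => (f a).conj := by
  unfold conj; fun_prop

theorem primrec_eqv {α : Type} [Primcodable α] {f g : α → GData} (hf : Primrec f)
    (hg : Primrec g) : PrimrecPred fun a => Eqv (f a) (g a) := by
  unfold Eqv
  exact (Primrec.eq.comp (by fun_prop) (by fun_prop)).and
    (Primrec.eq.comp (by fun_prop) (by fun_prop))

end GData

/-! ## Primitive recursive predicates -/

section Rules

variable {α β : Type} [Primcodable α] [Primcodable β]

theorem primrecPred_forall_mem {f : α → List β} {R : α → β → Prop} (hf : Primrec f)
    (hR : PrimrecPred fun p : α × β => R p.1 p.2) : PrimrecPred fun a => ∀ b ∈ f a, R a b := by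
  have h : PrimrecRel fun (b : β) (a : α) => R a b :=
    hR.comp (Primrec.pair Primrec.snd Primrec.fst)
  exact h.forall_mem_list.comp hf Primrec.id

theorem primrecPred_forall_lt {f : α → ℕ} {R : α → ℕ → Prop} (hf : Primrec f)
    (hR : PrimrecPred fun p : α × ℕ => R p.1 p.2) : PrimrecPred fun a => ∀ b < f a, R a b := by
  have := primrecPred_forall_mem (Primrec.list_range.comp hf) hR
  simpa only [List.mem_range] using this

theorem primrecPred_eq {f g : α → β} (hf : Primrec f) (hg : Primrec g) :
    PrimrecPred fun a => f a = g a := Primrec.eq.comp hf hg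

end Rules

/-! ## Codes of Gaussian rationals -/

/-- Integer data of a Gaussian rational. -/
abbrev Entry : Type := (ℤ × ℕ) × (ℤ × ℕ)

/-- The numbering of the integers puts non-negative ones at even places and negative ones at odd
places, so sign and size are read off by parity and halving. -/
theorem ofNat_int (n : ℕ) :
    Denumerable.ofNat ℤ n = if n % 2 = 0 then ((n / 2 : ℕ) : ℤ) else -((n / 2 + 1 : ℕ) : ℤ) := by
  have h : Denumerable.ofNat ℤ n = Equiv.intEquivNat.symm n := rfl
  rw [h, Equiv.symm_apply_eq]
  split_ifs with h2
  · have : Equiv.intEquivNat ((n / 2 : ℕ) : ℤ) = 2 * (n / 2) := rfl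
    omega
  · have h3 : -((n / 2 + 1 : ℕ) : ℤ) = Int.negSucc (n / 2) := rfl
    have : Equiv.intEquivNat (Int.negSucc (n / 2)) = 2 * (n / 2) + 1 := rfl
    rw [h3, this]
    omega

theorem primrec_toNat : Primrec Int.toNat := by
  refine Primrec.ofNat_iff.2 ?_
  have h : Primrec fun n : ℕ => if n % 2 = 0 then n / 2 else 0 :=
    Primrec.ite (Primrec.eq.comp (Primrec.nat_mod.comp Primrec.id (Primrec.const 2))
      (Primrec.const 0)) (Primrec.nat_div.comp Primrec.id (Primrec.const 2)) (Primrec.const 0)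
  refine h.of_eq fun n => ?_
  rw [ofNat_int]
  split_ifs <;> omega

theorem primrec_neg_toNat : Primrec fun z : ℤ => (-z).toNat := by
  refine Primrec.ofNat_iff.2 ?_
  have h : Primrec fun n : ℕ => if n % 2 = 0 then 0 else n / 2 + 1 :=
    Primrec.ite (Primrec.eq.comp (Primrec.nat_mod.comp Primrec.id (Primrec.const 2))
      (Primrec.const 0)) (Primrec.const 0)
      (Primrec.succ.comp (Primrec.nat_div.comp Primrec.id (Primrec.const 2)))
  refine h.of_eq fun n => ?_
  rw [ofNat_int]
  split_ifs <;> omega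

@[fun_prop] theorem primrec_toNat' {α : Type} [Primcodable α] {f : α → ℤ} (hf : Primrec f) :
    Primrec fun a => (f a).toNat := primrec_toNat.comp hf

@[fun_prop] theorem primrec_neg_toNat' {α : Type} [Primcodable α] {f : α → ℤ} (hf : Primrec f) :
    Primrec fun a => (-f a).toNat := primrec_neg_toNat.comp hf

/-- The number coded by an entry (with denominators `0` read as `1`). -/
def Entry.toData (c : Entry) : GData :=
  (((c.1.1.toNat * (c.2.2 - 1 + 1), (-c.1.1).toNat * (c.2.2 - 1 + 1)),
    (c.2.1.toNat * (c.1.2 - 1 + 1), (-c.2.1).toNat * (c.1.2 - 1 + 1))),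
    (c.1.2 - 1) * (c.2.2 - 1) + (c.1.2 - 1) + (c.2.2 - 1))

def Entry.val (c : Entry) : ℂ := (Entry.toData c).val

@[fun_prop] theorem primrec_toData {α : Type} [Primcodable α] {f : α → Entry} (hf : Primrec f) :
    Primrec fun a => (f a).toData := by
  unfold Entry.toData; fun_prop

theorem Entry.val_code (z : GRat) : Entry.val z.code = z.toComplex := by
  obtain ⟨p, q⟩ := z
  have hp : p.den - 1 + 1 = p.den := Nat.sub_add_cancel p.pos
  have hq : q.den - 1 + 1 = q.den := Nat.sub_add_cancel q.pos
  have hpc : ((p.den : ℕ) : ℂ) ≠ 0 := by exact_mod_cast p.den_nz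
  have hqc : ((q.den : ℕ) : ℂ) ≠ 0 := by exact_mod_cast q.den_nz
  have hd : (((p.den - 1) * (q.den - 1) + (p.den - 1) + (q.den - 1) : ℕ) : ℂ) + 1 =
      p.den * q.den := by
    have : (p.den - 1) * (q.den - 1) + (p.den - 1) + (q.den - 1) + 1 = p.den * q.den := by
      conv_rhs => rw [← hp, ← hq]
      ring
    exact_mod_cast this
  have hz : ∀ z : ℤ, ((z.toNat : ℂ) - (-z).toNat) = z := fun z => by
    have := Int.toNat_sub_toNat_neg z
    exact_mod_cast congrArg (Int.cast : ℤ → ℂ) this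
  have hcp : ((p : ℝ) : ℂ) = p.num / p.den := by
    rw [Complex.ofReal_ratCast]; exact Rat.cast_def p
  have hcq : ((q : ℝ) : ℂ) = q.num / q.den := by
    rw [Complex.ofReal_ratCast]; exact Rat.cast_def q
  have hL : GRat.toComplex (p, q) = ((p : ℝ) : ℂ) + ((q : ℝ) : ℂ) * Complex.I :=
    (Complex.re_add_im (GRat.toComplex (p, q))).symm
  rw [hL, hcp, hcq]
  simp only [Entry.val, Entry.toData, GData.val, GRat.code, hp, hq, hd]
  push_cast
  rw [← sub_mul, ← sub_mul, hz, hz]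
  field_simp

/-- The entry is the code of a Gaussian rational. -/
def Entry.IsCode (c : Entry) : Prop :=
  (c.1.2 ≠ 0 ∧ ∀ d < c.1.2 + 1, (c.1.1.toNat + (-c.1.1).toNat) % d = 0 → c.1.2 % d = 0 → d = 1) ∧
  (c.2.2 ≠ 0 ∧ ∀ d < c.2.2 + 1, (c.2.1.toNat + (-c.2.1).toNat) % d = 0 → c.2.2 % d = 0 → d = 1)

/-- A common divisor is at most n since n ≠ 0, so the search is bounded and the test for reduced
fractions is primitive recursive. -/
theorem coprime_iff_forall_lt (z : ℤ) {n : ℕ} (hn : n ≠ 0) : z.natAbs.Coprime n ↔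
    ∀ d < n + 1, (z.toNat + (-z).toNat) % d = 0 → n % d = 0 → d = 1 := by
  have hz : z.toNat + (-z).toNat = z.natAbs := by omega
  rw [hz]
  constructor
  · intro h d _ h1 h2
    exact Nat.eq_one_of_dvd_coprimes h (Nat.dvd_of_mod_eq_zero h1) (Nat.dvd_of_mod_eq_zero h2)
  · intro h
    refine h _ (Nat.lt_succ_of_le (Nat.le_of_dvd (Nat.pos_of_ne_zero hn) (Nat.gcd_dvd_right _ _)))
      (Nat.mod_eq_zero_of_dvd (Nat.gcd_dvd_left _ _))
      (Nat.mod_eq_zero_of_dvd (Nat.gcd_dvd_right _ _))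

theorem Entry.isCode_iff (c : Entry) : c.IsCode ↔ ∃ z : GRat, z.code = c := by
  constructor
  · rintro ⟨⟨h1, h2⟩, h3, h4⟩
    rw [← coprime_iff_forall_lt _ h1] at h2
    rw [← coprime_iff_forall_lt _ h3] at h4
    exact ⟨(⟨c.1.1, c.1.2, h1, h2⟩, ⟨c.2.1, c.2.2, h3, h4⟩), rfl⟩
  · rintro ⟨z, rfl⟩
    exact ⟨⟨z.1.den_nz, (coprime_iff_forall_lt _ z.1.den_nz).1 z.1.reduced⟩,
      z.2.den_nz, (coprime_iff_forall_lt _ z.2.den_nz).1 z.2.reduced⟩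

theorem primrecPred_isCode {α : Type} [Primcodable α] {f : α → Entry} (hf : Primrec f) :
    PrimrecPred fun a => (f a).IsCode := by
  have hm : ∀ {β : Type} [Primcodable β] {f g : β → ℕ}, Primrec f → Primrec g →
      PrimrecPred fun b => f b % g b = 0 := fun hf hg =>
    primrecPred_eq (Primrec.nat_mod.comp hf hg) (Primrec.const 0)
  have hi : ∀ {β : Type} [Primcodable β] {p q : β → Prop}, PrimrecPred p → PrimrecPred q →
      PrimrecPred fun b => p b → q b := fun hp hq =>
    (hp.not.or hq).of_eq fun b => (imp_iff_not_or).symm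
  have key : ∀ {g : α → ℤ × ℕ}, Primrec g → PrimrecPred fun a => (g a).2 ≠ 0 ∧
      ∀ d < (g a).2 + 1, ((g a).1.toNat + (-(g a).1).toNat) % d = 0 → (g a).2 % d = 0 → d = 1 := by
    intro g hg
    refine (primrecPred_eq (by fun_prop) (Primrec.const 0)).not.and
      (primrecPred_forall_lt (by fun_prop) ?_)
    exact hi (hm (by fun_prop) (by fun_prop)) (hi (hm (by fun_prop) (by fun_prop))
      (primrecPred_eq (by fun_prop) (Primrec.const 1)))
  exact (key (Primrec.fst.comp hf)).and (key (Primrec.snd.comp hf))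

/-! ## Sums -/

namespace GData

def zero : GData := (((0, 0), (0, 0)), 0)

def one : GData := (((1, 0), (0, 0)), 0)

def four : GData := (((4, 0), (0, 0)), 0)

/-- `2^{-k}`. -/
def halfPow (k : ℕ) : GData := (((1, 0), (0, 0)), 2 ^ k - 1)

theorem val_zero : zero.val = 0 := by simp [zero, val]

theorem val_one : one.val = 1 := by simp [one, val]

theorem val_four : four.val = 4 := by simp [four, val]

theorem val_halfPow (k : ℕ) : (halfPow k).val = (1 / 2) ^ k := by
  have h : ((2 ^ k - 1 : ℕ) : ℂ) + 1 = 2 ^ k := by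
    have : 2 ^ k - 1 + 1 = 2 ^ k := Nat.sub_add_cancel Nat.one_le_two_pow
    exact_mod_cast this
  simp [halfPow, val]

@[fun_prop] theorem primrec_halfPow {α : Type} [Primcodable α] {f : α → ℕ} (hf : Primrec f) :
    Primrec fun a => halfPow (f a) := by
  unfold halfPow; fun_prop

def sum (l : List GData) : GData := l.foldr add zero

theorem val_sum (l : List GData) : (sum l).val = (l.map val).sum := by
  induction l with
  | nil => exact val_zero
  | cons x l ih =>
    rw [List.map_cons, List.sum_cons, ← ih]
    exact val_add x _

theorem val_sum_range (n : ℕ) (f : ℕ → GData) :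
    (sum ((List.range n).map f)).val = ∑ i : Fin n, (f i).val := by
  rw [val_sum, List.map_map, Fin.sum_univ_eq_sum_range (fun i => (f i).val)]
  rfl

@[fun_prop] theorem primrec_sum {α : Type} [Primcodable α] {f : α → List GData} (hf : Primrec f) :
    Primrec fun a => sum (f a) :=
  (Primrec.list_foldr (h := fun _ (p : GData × GData) => p.1.add p.2)
    Primrec.id (Primrec.const zero)
    ((primrec_add Primrec.fst Primrec.snd).comp Primrec.snd)).comp hf

end GData

/-- The entry number `i` of a coded vector. -/
def entryAt (l : List Entry) (i : ℕ) : GData := (l.getD i ((0, 1), (0, 1))).toData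

@[fun_prop] theorem primrec_entryAt {α : Type} [Primcodable α] {f : α → List Entry} {g : α → ℕ}
    (hf : Primrec f) (hg : Primrec g) : Primrec fun a => entryAt (f a) (g a) := by
  unfold entryAt; fun_prop

/-- `x · conj y`. -/
def GData.mulConj (x y : GData) : GData := x.mul y.conj

@[fun_prop] theorem GData.primrec_mulConj {α : Type} [Primcodable α] {f g : α → GData}
    (hf : Primrec f) (hg : Primrec g) : Primrec fun a => (f a).mulConj (g a) := by
  unfold mulConj; fun_prop

theorem GData.val_mulConj (x y : GData) : (x.mulConj y).val = x.val * star y.val := by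
  rw [mulConj, val_mul, val_conj]

/-! ## Certificates of domination by elementary states -/

/-- A certificate that a positive matrix is dominated by a dyadic combination of elementary states:
weighted states, vectors summing to the difference, and numbers summing to the trace defect. -/
abbrev Certificate : Type := List (ℕ × List Entry) × List (List Entry) × List Entry

/-- The list is a code of a unit vector of dimension `N`. -/
def IsUnitCode (N : ℕ) (l : List Entry) : Prop :=
  l.length = N ∧
    GData.Eqv (GData.sum ((List.range N).map fun i => (entryAt l i).mulConj (entryAt l i)))
      GData.one

theorem primrecPred_isUnitCode {α : Type} [Primcodable α] {f : α → ℕ} {g : α → List Entry}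
    (hf : Primrec f) (hg : Primrec g) : PrimrecPred fun a => IsUnitCode (f a) (g a) :=
  (primrecPred_eq (by fun_prop) hf).and (GData.primrec_eqv (by fun_prop) (Primrec.const _))

/-- The certificate is valid for the `N × N` matrix `M`. -/
def Certificate.Valid (N : ℕ) (M : ℕ → ℕ → GData) (w : Certificate) : Prop :=
  (∀ r ∈ w.1, IsUnitCode N r.2 ∧ ∀ c ∈ r.2, Entry.IsCode c) ∧
  -- Positivity of the excess and the bound on the weights are witnessed by explicit squares. Only
  -- equations between rational numbers remain to be checked.
  (∀ i < N, ∀ j < N, GData.Eqv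
    (GData.sum (w.1.map fun r =>
      (GData.halfPow r.1).mul ((entryAt r.2 i).mulConj (entryAt r.2 j))))
    ((M i j).add (GData.sum (w.2.1.map fun u => (entryAt u i).mulConj (entryAt u j))))) ∧
  GData.Eqv
    ((GData.sum (w.1.map fun r => GData.halfPow r.1)).add
      (GData.sum (w.2.2.map fun c => c.toData.mulConj c.toData)))
    (GData.four.mul (GData.sum ((List.range N).map fun i => M i i)))

theorem primrecPred_valid {α : Type} [Primcodable α] {N : α → ℕ} {M : α → ℕ → ℕ → GData}
    (hN : Primrec N) (hM : Primrec fun p : α × ℕ × ℕ => M p.1 p.2.1 p.2.2) :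
    PrimrecPred fun p : α × Certificate => p.2.Valid (N p.1) (M p.1) := by
  have hM' : ∀ {β : Type} [Primcodable β] {f : β → α} {g h : β → ℕ}, Primrec f → Primrec g →
      Primrec h → Primrec fun b => M (f b) (g b) (h b) := fun hf hg hh =>
    hM.comp (Primrec.pair hf (Primrec.pair hg hh))
  refine (primrecPred_forall_mem (by fun_prop) ?_).and
    ((primrecPred_forall_lt (by fun_prop) (primrecPred_forall_lt (by fun_prop) ?_)).and ?_)
  · exact (primrecPred_isUnitCode (by fun_prop) (by fun_prop)).and
      (primrecPred_forall_mem (by fun_prop) (primrecPred_isCode (by fun_prop)))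
  · have := hM' (f := fun p : ((α × Certificate) × ℕ) × ℕ => p.1.1.1) (g := fun p => p.1.2)
      (h := fun p => p.2) (by fun_prop) (by fun_prop) (by fun_prop)
    exact GData.primrec_eqv (by fun_prop) (by fun_prop)
  · have := hM' (f := fun p : (α × Certificate) × ℕ => p.1.1) (g := fun p => p.2)
      (h := fun p => p.2) (by fun_prop) (by fun_prop) (by fun_prop)
    exact GData.primrec_eqv (by fun_prop) (by fun_prop)

open Classical in
/-- The first valid certificate. -/
def findCertificate (N : ℕ) (M : ℕ → ℕ → GData) : Part Certificate :=
  Nat.rfindOpt fun k => (Encodable.decode (α := Certificate) k).bind fun w =>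
    if w.Valid N M then some w else none

theorem partrec_findCertificate {α : Type} [Primcodable α] {N : α → ℕ} {M : α → ℕ → ℕ → GData}
    (hN : Primrec N) (hM : Primrec fun p : α × ℕ × ℕ => M p.1 p.2.1 p.2.2) :
    Partrec fun a => findCertificate (N a) (M a) := by
  classical
  refine Partrec.rfindOpt (Primrec.to_comp ?_)
  refine Primrec.option_bind (Primrec.decode.comp Primrec.snd) ?_
  refine Primrec.ite ?_ (Primrec.option_some.comp Primrec.snd) (Primrec.const none)
  exact (primrecPred_valid hN hM).comp
    (Primrec.pair (Primrec.fst.comp Primrec.fst) Primrec.snd)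

theorem valid_of_mem_findCertificate {N : ℕ} {M : ℕ → ℕ → GData} {w : Certificate}
    (h : w ∈ findCertificate N M) : w.Valid N M := by
  obtain ⟨k, hk⟩ := Nat.rfindOpt_spec h
  rw [Option.mem_def, Option.bind_eq_some_iff] at hk
  obtain ⟨w', -, h2⟩ := hk
  split_ifs at h2 with h3
  exact (Option.some.inj h2) ▸ h3

theorem findCertificate_dom {N : ℕ} {M : ℕ → ℕ → GData} {w : Certificate} (h : w.Valid N M) :
    (findCertificate N M).Dom :=
  Nat.rfindOpt_dom.2 ⟨Encodable.encode w, w, by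
    rw [Encodable.encodek, Option.mem_def, Option.bind_some, if_pos h]⟩

open Matrix

/-! ## The field of Gaussian rationals -/

/-- The complex numbers with rational real and imaginary parts. -/
def gaussRat : Subfield ℂ where
  carrier := {z | ∃ w : GRat, w.toComplex = z}
  mul_mem' := by
    rintro _ _ ⟨a, rfl⟩ ⟨b, rfl⟩
    exact ⟨(a.1 * b.1 - a.2 * b.2, a.1 * b.2 + a.2 * b.1), by
      apply Complex.ext <;> simp [GRat.toComplex]⟩
  add_mem' := by
    rintro _ _ ⟨a, rfl⟩ ⟨b, rfl⟩
    exact ⟨(a.1 + b.1, a.2 + b.2), by apply Complex.ext <;> simp [GRat.toComplex]⟩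
  neg_mem' := by
    rintro _ ⟨a, rfl⟩
    exact ⟨(-a.1, -a.2), by apply Complex.ext <;> simp [GRat.toComplex]⟩
  one_mem' := ⟨(1, 0), by apply Complex.ext <;> simp [GRat.toComplex]⟩
  zero_mem' := ⟨(0, 0), by apply Complex.ext <;> simp [GRat.toComplex]⟩
  inv_mem' := by
    rintro _ ⟨a, rfl⟩
    refine ⟨(a.1 / (a.1 * a.1 + a.2 * a.2), -a.2 / (a.1 * a.1 + a.2 * a.2)), ?_⟩
    apply Complex.ext <;> simp [GRat.toComplex, Complex.inv_re, Complex.inv_im, Complex.normSq]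

theorem I_mem : Complex.I ∈ gaussRat :=
  ⟨(0, 1), by apply Complex.ext <;> simp [GRat.toComplex]⟩

theorem star_mem {z : ℂ} (h : z ∈ gaussRat) : star z ∈ gaussRat := by
  obtain ⟨a, rfl⟩ := h
  exact ⟨(a.1, -a.2), by apply Complex.ext <;> simp [GRat.toComplex]⟩

theorem GData.val_mem (x : GData) : x.val ∈ gaussRat :=
  div_mem (add_mem (sub_mem (natCast_mem _ _) (natCast_mem _ _))
    (mul_mem (sub_mem (natCast_mem _ _) (natCast_mem _ _)) I_mem))
    (add_mem (natCast_mem _ _) (one_mem _))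

theorem exists_rat_of_nonneg {c : ℂ} (hc : c ∈ gaussRat) (h0 : 0 ≤ c) :
    ∃ q : ℚ, 0 ≤ q ∧ c = q := by
  obtain ⟨a, rfl⟩ := hc
  obtain ⟨h1, h2⟩ := Complex.nonneg_iff.1 h0
  refine ⟨a.1, by simpa [GRat.toComplex] using h1, ?_⟩
  apply Complex.ext
  · simp [GRat.toComplex]
  · simpa [GRat.toComplex] using h2.symm

/-- Write a/d as ad/d² and split ad into four squares; they pair up into the squared moduli of two
Gaussian rationals. -/
theorem exists_sum_two_norms (q : ℚ) (hq : 0 ≤ q) :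
    ∃ z ∈ gaussRat, ∃ w ∈ gaussRat, (q : ℂ) = z * star z + w * star w := by
  obtain ⟨a, b, c, d, h⟩ := Nat.sum_four_squares (q.num.toNat * q.den)
  have hD : (q.den : ℂ) ≠ 0 := by exact_mod_cast q.den_nz
  refine ⟨(a + b * Complex.I) / q.den, ?_, (c + d * Complex.I) / q.den, ?_, ?_⟩
  · exact div_mem (add_mem (natCast_mem _ _) (mul_mem (natCast_mem _ _) I_mem)) (natCast_mem _ _)
  · exact div_mem (add_mem (natCast_mem _ _) (mul_mem (natCast_mem _ _) I_mem)) (natCast_mem _ _)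
  · have h1 : (q : ℂ) = q.num.toNat / q.den := by
      have h2 : ((q.num.toNat : ℤ) : ℂ) = q.num := by
        rw [Int.toNat_of_nonneg (Rat.num_nonneg.2 hq)]
      rw [Rat.cast_def, ← h2]
      norm_cast
    have h3 : (a : ℂ) ^ 2 + b ^ 2 + c ^ 2 + d ^ 2 = q.num.toNat * q.den := by exact_mod_cast h
    simp only [Complex.star_def, map_div₀, map_add, map_mul, Complex.conj_natCast, Complex.conj_I]
    rw [h1]
    field_simp
    linear_combination -h3 + (b ^ 2 + d ^ 2 : ℂ) * Complex.I_sq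

/-! ## Sums of rational rank-one matrices -/

/-- The matrix `|v⟩⟨v|`. -/
def rankOne {N : ℕ} (v : Fin N → ℂ) : Matrix (Fin N) (Fin N) ℂ := vecMulVec v (star v)

theorem rankOne_apply {N : ℕ} (v : Fin N → ℂ) (i j : Fin N) :
    rankOne v i j = v i * star (v j) := rfl

/-- The cone of sums of matrices `|v⟩⟨v|` with Gaussian rational `v`. -/
def rationalCone (N : ℕ) : AddSubmonoid (Matrix (Fin N) (Fin N) ℂ) :=
  AddSubmonoid.closure {A | ∃ v : Fin N → ℂ, (∀ i, v i ∈ gaussRat) ∧ A = rankOne v}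

theorem rankOne_mem {N : ℕ} {v : Fin N → ℂ} (hv : ∀ i, v i ∈ gaussRat) :
    rankOne v ∈ rationalCone N := AddSubmonoid.subset_closure ⟨v, hv, rfl⟩

theorem exists_list_of_mem_rationalCone {N : ℕ} {A : Matrix (Fin N) (Fin N) ℂ}
    (hA : A ∈ rationalCone N) :
    ∃ l : List (Fin N → ℂ), (∀ v ∈ l, ∀ i, v i ∈ gaussRat) ∧ A = (l.map rankOne).sum := by
  induction hA using AddSubmonoid.closure_induction with
  | mem A h =>
    obtain ⟨v, hv, rfl⟩ := h
    exact ⟨[v], by simpa using hv, by simp⟩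
  | zero => exact ⟨[], by simp, by simp⟩
  | add A B _ _ hA hB =>
    obtain ⟨l, hl, rfl⟩ := hA
    obtain ⟨l', hl', rfl⟩ := hB
    refine ⟨l ++ l', ?_, by simp⟩
    intro v hv
    rcases List.mem_append.1 hv with h | h
    exacts [hl v h, hl' v h]

/-- The square root of the scalar may be irrational, so the scalar is split as |z|² + |w|² and the
vector is replaced by its multiples by z and w. -/
theorem smul_mem_rationalCone {N : ℕ} {A : Matrix (Fin N) (Fin N) ℂ} (hA : A ∈ rationalCone N)
    {c : ℂ} (hc : c ∈ gaussRat) (h0 : 0 ≤ c) : c • A ∈ rationalCone N := by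
  obtain ⟨q, hq, rfl⟩ := exists_rat_of_nonneg hc h0
  obtain ⟨z, hz, w, hw, h⟩ := exists_sum_two_norms q hq
  induction hA using AddSubmonoid.closure_induction with
  | mem A hA =>
    obtain ⟨v, hv, rfl⟩ := hA
    have : (q : ℂ) • rankOne v = rankOne (z • v) + rankOne (w • v) := by
      ext i j
      simp only [Matrix.smul_apply, Matrix.add_apply, rankOne_apply, Pi.smul_apply, smul_eq_mul,
        star_mul, h]
      ring
    rw [this]
    exact add_mem (rankOne_mem fun i => mul_mem hz (hv i)) (rankOne_mem fun i => mul_mem hw (hv i))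
  | zero => rw [smul_zero]; exact zero_mem _
  | add A B _ _ hA hB => rw [smul_add]; exact add_mem hA hB

theorem posSemidef_rankOne {N : ℕ} (v : Fin N → ℂ) : (rankOne v).PosSemidef :=
  posSemidef_vecMulVec_self_star v

/-- One step of symmetric Gaussian elimination preserves positivity. -/
theorem posSemidef_sub_rankOne {N : ℕ} {M : Matrix (Fin N) (Fin N) ℂ} (hM : M.PosSemidef)
    (k : Fin N) (hk : M k k ≠ 0) : (M - (M k k)⁻¹ • rankOne (fun i => M i k)).PosSemidef := by
  have hH : ∀ i j, star (M i j) = M j i := fun i j => hM.1.apply j i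
  let C : Matrix (Fin N) (Fin N) ℂ :=
    1 - (M k k)⁻¹ • vecMulVec (Pi.single k 1) (fun j => M k j)
  have hC : ∀ i j, C i j = (1 : Matrix (Fin N) (Fin N) ℂ) i j -
      (M k k)⁻¹ * ((Pi.single k 1 : Fin N → ℂ) i * M k j) := fun i j => rfl
  have h1 : ∀ i j, (M * C) i j = M i j - (M k k)⁻¹ * (M i k * M k j) := by
    intro i j
    have : M * C = M - (M k k)⁻¹ • vecMulVec (M *ᵥ Pi.single k 1) (fun j => M k j) := by
      rw [mul_sub, mul_one, Matrix.mul_smul, mul_vecMulVec]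
    rw [this]
    simp [vecMulVec_apply]
  -- The Schur complement is a congruence of `M`, hence positive: `C` clears the k-th row, so the
  -- correction term in `Cᴴ` meets only zeros.
  have h2 : Cᴴ * M * C = M - (M k k)⁻¹ • rankOne (fun i => M i k) := by
    ext i j
    rw [Matrix.mul_assoc, Matrix.mul_apply]
    simp only [conjTranspose_apply, hC, h1, star_sub, star_mul, star_inv₀, hH]
    simp only [sub_mul, Finset.sum_sub_distrib]
    have e1 : ∑ x, star ((1 : Matrix (Fin N) (Fin N) ℂ) x i) *
        (M x j - (M k k)⁻¹ * (M x k * M k j)) = M i j - (M k k)⁻¹ * (M i k * M k j) := by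
      rw [Finset.sum_eq_single i]
      · simp
      · intro b _ hb; simp [hb]
      · simp
    have e2 : ∑ x, M i k * star ((Pi.single k 1 : Fin N → ℂ) x) * (M k k)⁻¹ *
        (M x j - (M k k)⁻¹ * (M x k * M k j)) = 0 := by
      rw [Finset.sum_eq_single k]
      · simp only [Pi.single_eq_same, star_one]
        field_simp
        ring
      · intro b _ hb; simp [hb]
      · simp
    rw [e1, e2, sub_zero, Matrix.sub_apply, Matrix.smul_apply, rankOne_apply, hH, smul_eq_mul]
  rw [← h2]
  exact hM.conjTranspose_mul_mul_same C

theorem mem_rationalCone_of_posSemidef {N : ℕ} {M : Matrix (Fin N) (Fin N) ℂ}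
    (hM : M.PosSemidef) (hK : ∀ i j, M i j ∈ gaussRat) : M ∈ rationalCone N := by
  classical
  induction hn : (Finset.univ.filter fun i => M i i ≠ 0).card using Nat.strong_induction_on
    generalizing M with
  | _ n ih =>
    by_cases h0 : ∃ k, M k k ≠ 0
    · obtain ⟨k, hk⟩ := h0
      have hpos : 0 ≤ (M k k)⁻¹ := by
        have := hM.diag_nonneg (i := k)
        exact inv_nonneg.2 this
      have hinv : (M k k)⁻¹ ∈ gaussRat := inv_mem (hK k k)
      have hP := posSemidef_sub_rankOne hM k hk
      set M' := M - (M k k)⁻¹ • rankOne (fun i => M i k) with hM'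
      have hMM : M = M' + (M k k)⁻¹ • rankOne (fun i => M i k) := by rw [hM', sub_add_cancel]
      have hent : ∀ i j, M' i j = M i j - (M k k)⁻¹ * (M i k * star (M j k)) := fun i j => rfl
      rw [hMM]
      refine add_mem (ih _ ?_ hP (fun i j => ?_) rfl)
        (smul_mem_rationalCone (rankOne_mem fun i => hK i k) hinv hpos)
      · rw [← hn]
        -- The pivot's own diagonal entry vanishes. A diagonal entry that is already zero stays so:
        -- subtraction could only lower it, and positivity of the complement forbids that.
        refine Finset.card_lt_card (Finset.ssubset_iff_of_subset ?_ |>.2 ⟨k, by simpa using hk, ?_⟩)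
        · intro i hi
          rw [Finset.mem_filter] at hi ⊢
          refine ⟨hi.1, fun hz => hi.2 ?_⟩
          refine le_antisymm ?_ hP.diag_nonneg
          rw [hent, hz, zero_sub, neg_nonpos]
          exact mul_nonneg hpos (mul_star_self_nonneg _)
        · have : star (M k k) = M k k := hM.1.apply k k
          simp only [Finset.mem_filter, not_and, not_not, hent, this]
          intro _
          field_simp
          ring
      · rw [hent]
        exact sub_mem (hK i j) (mul_mem hinv (mul_mem (hK i k) (star_mem (hK j k))))
    · push Not at h0
      have : M = 0 := hM.trace_eq_zero_iff.1 (by simp [Matrix.trace, h0])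
      rw [this]; exact zero_mem _

/-! ## Domination of a rational vector by two elementary states -/

theorem trace_rankOne {N : ℕ} (v : Fin N → ℂ) : (rankOne v).trace = ∑ i, v i * star (v i) := rfl

theorem trace_rankOne_nonneg {N : ℕ} (v : Fin N → ℂ) : 0 ≤ (rankOne v).trace :=
  (posSemidef_rankOne v).trace_nonneg

/-- This extends (a, b) ↦ (−b̄, ā) to even dimension. Reverse and conjugate the coordinates, with a
sign that changes under reversal; the inner product with `v` is then its own negative, and the norm
is kept. -/
theorem exists_orthogonal_partner (n : ℕ) (v : Fin (2 ^ (n + 1)) → ℂ)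
    (hv : ∀ i, v i ∈ gaussRat) : ∃ u : Fin (2 ^ (n + 1)) → ℂ, (∀ i, u i ∈ gaussRat) ∧
      (rankOne u).trace = (rankOne v).trace ∧ ∑ i, v i * star (u i) = 0 := by
  let s : Fin (2 ^ (n + 1)) → ℂ := fun i => if i.val < 2 ^ n then 1 else -1
  have hs : ∀ i, s i = 1 ∨ s i = -1 := fun i => by
    simp only [s]; split_ifs <;> simp
  have hrev : ∀ i, s i.rev = - s i := fun i => by
    have h1 : (i.rev : ℕ) = 2 ^ (n + 1) - (i + 1) := Fin.val_rev i
    have h2 := i.isLt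
    have h3 : 2 ^ (n + 1) = 2 ^ n * 2 := pow_succ 2 n
    simp only [s]
    split_ifs with h4 h5 h5
    · omega
    · simp
    · simp
    · omega
  have hreal : ∀ i, star (s i) = s i := fun i => by rcases hs i with h | h <;> simp [h]
  have hsq : ∀ i, s i * s i = 1 := fun i => by rcases hs i with h | h <;> simp [h]
  refine ⟨fun i => s i * star (v i.rev), fun i => mul_mem ?_ (star_mem (hv _)), ?_, ?_⟩
  · rcases hs i with h | h <;> rw [h]
    exacts [one_mem _, neg_mem (one_mem _)]
  · rw [trace_rankOne, trace_rankOne, ← Equiv.sum_comp Fin.revPerm]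
    refine Finset.sum_congr rfl fun i _ => ?_
    simp only [Fin.revPerm_apply, Fin.rev_rev, star_mul, star_star, hreal]
    linear_combination (v i * star (v i)) * hsq i.rev
  · have h : ∑ i, v i * star (s i * star (v i.rev)) =
        - ∑ i, v i * star (s i * star (v i.rev)) := by
      conv_lhs => rw [← Equiv.sum_comp Fin.revPerm]
      rw [← Finset.sum_neg_distrib]
      refine Finset.sum_congr rfl fun i _ => ?_
      simp only [Fin.revPerm_apply, Fin.rev_rev, star_mul, star_star, hreal, hrev, star_neg]
      ring
    exact self_eq_neg.1 h

/-- Normalizing `v` may need an irrational factor. With u ⊥ v of the same norm, αv + βu and αv − βu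
are unit vectors whenever |α|² + |β|² is the inverse of ‖v‖², which has a rational solution by four
squares. The cross terms cancel in the sum of the two projections. -/
theorem exists_unit_pair {n : ℕ} (v : Fin (2 ^ n) → ℂ) (hv : ∀ i, v i ∈ gaussRat) (hv0 : v ≠ 0) :
    ∃ φ ψ : Fin (2 ^ n) → ℂ, (∀ i, φ i ∈ gaussRat) ∧ (∀ i, ψ i ∈ gaussRat) ∧
      (rankOne φ).trace = 1 ∧ (rankOne ψ).trace = 1 ∧
      ∃ a ∈ gaussRat, ∃ S ∈ rationalCone (2 ^ n), 0 ≤ a ∧ 1 ≤ (rankOne v).trace * a ∧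
        rankOne φ + rankOne ψ = a • rankOne v + S := by
  have hr0 := trace_rankOne_nonneg v
  have hrK : (rankOne v).trace ∈ gaussRat :=
    sum_mem fun i _ => mul_mem (hv i) (star_mem (hv i))
  have hrne : (rankOne v).trace ≠ 0 := fun h => hv0 <| by
    have := (posSemidef_rankOne v).trace_eq_zero_iff.1 h
    funext i
    have h2 := congrFun (congrFun this i) i
    rw [rankOne_apply] at h2
    simpa using h2
  cases n with
  | zero =>
    -- In dimension one there is no orthogonal partner, but |v⟩⟨v| divided by its trace is already
    -- the identity.
    refine ⟨fun _ => 1, fun _ => 1, fun _ => one_mem _, fun _ => one_mem _, by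
      simp [trace_rankOne], by simp [trace_rankOne], ((rankOne v).trace)⁻¹, inv_mem hrK,
      rankOne (fun _ => 1), rankOne_mem fun _ => one_mem _, inv_nonneg.2 hr0, ?_, ?_⟩
    · rw [mul_inv_cancel₀ hrne]
    · congr 1
      have hu : ∀ i : Fin (2 ^ 0), i = 0 := fun i => Fin.fin_one_eq_zero i
      have ht : (rankOne v).trace = v 0 * star (v 0) := by
        rw [trace_rankOne]; exact Fin.sum_univ_one _
      ext i j
      rw [hu i, hu j, Matrix.smul_apply, ht, rankOne_apply, rankOne_apply, smul_eq_mul,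
        inv_mul_cancel₀ (ht ▸ hrne)]
      simp
  | succ n =>
    obtain ⟨u, hu, hut, huv⟩ := exists_orthogonal_partner n v hv
    have huv' : ∑ i, u i * star (v i) = 0 := by
      have := congrArg star huv
      rw [star_sum, star_zero] at this
      rw [← this]
      exact Finset.sum_congr rfl fun i _ => by rw [star_mul, star_star]
    set r := (rankOne v).trace with hr
    obtain ⟨q, hq, hqr⟩ := exists_rat_of_nonneg (inv_mem hrK) (inv_nonneg.2 hr0)
    -- Giving the larger part to `α` ensures 2|α|² ≥ 1/r, so that the coefficient of |v⟩⟨v|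
    -- suffices.
    obtain ⟨α, hα, β, hβ, hαβ, hle⟩ : ∃ α ∈ gaussRat, ∃ β ∈ gaussRat,
        r⁻¹ = α * star α + β * star β ∧ β * star β ≤ α * star α := by
      obtain ⟨α, hα, β, hβ, h⟩ := exists_sum_two_norms q hq
      have e : ∀ z : ℂ, z * star z = ((Complex.normSq z : ℝ) : ℂ) := fun z => Complex.mul_conj z
      rcases le_total (Complex.normSq β) (Complex.normSq α) with h1 | h1
      · exact ⟨α, hα, β, hβ, hqr.trans h, by rw [e, e]; exact_mod_cast h1⟩
      · exact ⟨β, hβ, α, hα, hqr.trans (h.trans (add_comm _ _)), by rw [e, e]; exact_mod_cast h1⟩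
    have hexp : ∀ ε : ℂ, ε * star ε = 1 → (rankOne (α • v + (ε * β) • u)).trace = 1 := by
      intro ε hε
      have : (rankOne (α • v + (ε * β) • u)).trace =
          α * star α * r + (ε * star ε) * (β * star β) * (rankOne u).trace +
          (α * star (ε * β)) * ∑ i, v i * star (u i) +
          (ε * β * star α) * ∑ i, u i * star (v i) := by
        rw [hr, trace_rankOne, trace_rankOne, trace_rankOne]
        simp only [Finset.mul_sum, ← Finset.sum_add_distrib]
        refine Finset.sum_congr rfl fun i _ => ?_
        simp only [Pi.add_apply, Pi.smul_apply, smul_eq_mul, star_add, star_mul]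
        ring
      rw [this, huv, huv', hut, hε, mul_zero, mul_zero, add_zero, add_zero, one_mul, ← add_mul,
        ← hαβ, inv_mul_cancel₀ hrne]
    have hα2 : 0 ≤ α * star α := mul_star_self_nonneg α
    have hβ2 : 0 ≤ β * star β := mul_star_self_nonneg β
    refine ⟨α • v + ((1 : ℂ) * β) • u, α • v + ((-1 : ℂ) * β) • u, fun i => ?_, fun i => ?_,
      hexp 1 (by simp), hexp (-1) (by simp), 2 * (α * star α), ?_, (2 * (β * star β)) • rankOne u,
      ?_, by positivity, ?_, ?_⟩
    · exact add_mem (mul_mem hα (hv i)) (mul_mem (mul_mem (one_mem _) hβ) (hu i))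
    · exact add_mem (mul_mem hα (hv i))
        (mul_mem (mul_mem (neg_mem (one_mem _)) hβ) (hu i))
    · exact mul_mem (ofNat_mem _ _) (mul_mem hα (star_mem hα))
    · exact smul_mem_rationalCone (rankOne_mem hu)
        (mul_mem (ofNat_mem _ _) (mul_mem hβ (star_mem hβ))) (by positivity)
    · calc (1 : ℂ) = r * r⁻¹ := (mul_inv_cancel₀ hrne).symm
        _ ≤ r * (2 * (α * star α)) := by
          refine mul_le_mul_of_nonneg_left ?_ hr0
          rw [hαβ, two_mul]
          exact add_le_add le_rfl hle
    · ext i j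
      simp only [Matrix.add_apply, Matrix.smul_apply, rankOne_apply, Pi.add_apply, Pi.smul_apply,
        smul_eq_mul, star_add, star_mul, star_one, star_neg]
      ring

/-! ## Existence of certificates -/

theorem exists_half_pow_near {r : ℝ} (h0 : 0 < r) (h1 : r ≤ 1) :
    ∃ k : ℕ, r ≤ (1 / 2) ^ k ∧ (1 / 2) ^ k ≤ 2 * r := by
  obtain ⟨m, hm1, hm2⟩ := exists_nat_pow_near_of_lt_one h0 h1
    (by norm_num : (0 : ℝ) < 1 / 2) (by norm_num)
  refine ⟨m, hm2, ?_⟩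
  rw [pow_succ] at hm1
  linarith

theorem posSemidef_of_mem_rationalCone {N : ℕ} {A : Matrix (Fin N) (Fin N) ℂ}
    (hA : A ∈ rationalCone N) : A.PosSemidef := by
  induction hA using AddSubmonoid.closure_induction with
  | mem A h => obtain ⟨v, -, rfl⟩ := h; exact posSemidef_rankOne v
  | zero => exact PosSemidef.zero
  | add A B _ _ hA hB => exact hA.add hB

theorem half_pow_mem (k : ℕ) : ((1 / 2 : ℂ)) ^ k ∈ gaussRat :=
  pow_mem (div_mem (one_mem _) (ofNat_mem _ _)) k

theorem half_pow_nonneg (k : ℕ) : (0 : ℂ) ≤ (1 / 2) ^ k := by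
  refine pow_nonneg ?_ k
  rw [Complex.nonneg_iff]; norm_num

/-- A list of dyadic weights and rational unit vectors. -/
def IsStateList {N : ℕ} (L : List (ℕ × (Fin N → ℂ))) : Prop :=
  ∀ x ∈ L, (∀ i, x.2 i ∈ gaussRat) ∧ (rankOne x.2).trace = 1

/-- With r = ‖v‖², the two states of `exists_unit_pair` get a common weight 2^{-k} between r and 2r.
The lower bound makes them cover |v⟩⟨v|, the upper one bounds the total weight by 4r; r ≤ 1 makes k
a natural number. -/
theorem exists_states_rankOne {n : ℕ} (v : Fin (2 ^ n) → ℂ) (hv : ∀ i, v i ∈ gaussRat)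
    (h1 : (rankOne v).trace ≤ 1) : ∃ L : List (ℕ × (Fin (2 ^ n) → ℂ)), IsStateList L ∧
      ∃ S ∈ rationalCone (2 ^ n),
        (L.map fun x => (1 / 2 : ℂ) ^ x.1 • rankOne x.2).sum = rankOne v + S ∧
        (L.map fun x => (1 / 2 : ℂ) ^ x.1).sum ≤ 4 * (rankOne v).trace := by
  by_cases hv0 : v = 0
  · refine ⟨[], fun x hx => by simp at hx, 0, zero_mem _, ?_, ?_⟩
    · subst hv0; ext i j; simp [rankOne_apply]
    · exact mul_nonneg (by positivity) (trace_rankOne_nonneg v)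
  · obtain ⟨φ, ψ, hφ, hψ, hφ1, hψ1, a, ha, S, hS, ha0, hra, hsum⟩ := exists_unit_pair v hv hv0
    have hr0 := trace_rankOne_nonneg v
    have hrne : (rankOne v).trace ≠ 0 := fun h => by
      rw [h, zero_mul] at hra
      exact absurd (Complex.le_def.1 hra).1 (by norm_num)
    obtain ⟨r, hr⟩ : ∃ r : ℝ, (rankOne v).trace = r :=
      ⟨_, (Complex.eq_re_of_ofReal_le (r := 0) (by simpa using hr0))⟩
    rw [hr] at hr0 h1 hrne hra ⊢
    have hr1 : r ≤ 1 := by exact_mod_cast h1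
    have hrpos : 0 < r := lt_of_le_of_ne (by exact_mod_cast hr0) fun h => hrne (by rw [← h]; simp)
    obtain ⟨k, hk1, hk2⟩ := exists_half_pow_near hrpos hr1
    have hk1' : (r : ℂ) ≤ (1 / 2) ^ k := by
      have : ((r : ℝ) : ℂ) ≤ (((1 / 2 : ℝ) ^ k : ℝ) : ℂ) := by exact_mod_cast hk1
      simpa using this
    have hk2' : (1 / 2 : ℂ) ^ k ≤ 2 * r := by
      have : (((1 / 2 : ℝ) ^ k : ℝ) : ℂ) ≤ ((2 * r : ℝ) : ℂ) := by exact_mod_cast hk2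
      simpa using this
    refine ⟨[(k, φ), (k, ψ)], ?_, ((1 / 2) ^ k * a - 1) • rankOne v + (1 / 2 : ℂ) ^ k • S, ?_,
      ?_, ?_⟩
    · intro x hx
      simp only [List.mem_cons, List.not_mem_nil, or_false] at hx
      rcases hx with rfl | rfl
      exacts [⟨hφ, hφ1⟩, ⟨hψ, hψ1⟩]
    · refine add_mem (smul_mem_rationalCone (rankOne_mem hv)
        (sub_mem (mul_mem (half_pow_mem k) ha) (one_mem _)) ?_)
        (smul_mem_rationalCone hS (half_pow_mem k) (half_pow_nonneg k))
      exact sub_nonneg.2 (hra.trans (mul_le_mul_of_nonneg_right hk1' ha0))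
    · simp only [List.map_cons, List.map_nil, List.sum_cons, List.sum_nil, add_zero]
      rw [← smul_add, hsum]
      module
    · simp only [List.map_cons, List.map_nil, List.sum_cons, List.sum_nil, add_zero]
      calc (1 / 2 : ℂ) ^ k + (1 / 2) ^ k ≤ 2 * r + 2 * r := add_le_add hk2' hk2'
        _ = 4 * r := by ring

theorem exists_states_list {n : ℕ} (l : List (Fin (2 ^ n) → ℂ))
    (hl : ∀ v ∈ l, ∀ i, v i ∈ gaussRat) (h1 : (l.map rankOne).sum.trace ≤ 1) :
    ∃ L : List (ℕ × (Fin (2 ^ n) → ℂ)), IsStateList L ∧ ∃ S ∈ rationalCone (2 ^ n),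
      (L.map fun x => (1 / 2 : ℂ) ^ x.1 • rankOne x.2).sum = (l.map rankOne).sum + S ∧
      (L.map fun x => (1 / 2 : ℂ) ^ x.1).sum ≤ 4 * (l.map rankOne).sum.trace := by
  induction l with
  | nil => exact ⟨[], fun x hx => by simp at hx, 0, zero_mem _, by simp, by simp⟩
  | cons v l ih =>
    have hv := hl v (by simp)
    have hl' : ∀ v ∈ l, ∀ i, v i ∈ gaussRat := fun u hu => hl u (by simp [hu])
    have ht : (0 : ℂ) ≤ (l.map rankOne).sum.trace := by
      refine (posSemidef_of_mem_rationalCone (list_sum_mem ?_)).trace_nonneg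
      intro A hA
      obtain ⟨u, hu, rfl⟩ := List.mem_map.1 hA
      exact rankOne_mem (hl' u hu)
    rw [List.map_cons, List.sum_cons, trace_add] at h1
    obtain ⟨L, hL, S, hS, e1, e2⟩ := ih hl' ((le_add_of_nonneg_left (trace_rankOne_nonneg v)).trans h1)
    obtain ⟨L', hL', S', hS', e1', e2'⟩ :=
      exists_states_rankOne v hv ((le_add_of_nonneg_right ht).trans h1)
    refine ⟨L' ++ L, ?_, S' + S, add_mem hS' hS, ?_, ?_⟩
    · intro x hx
      rcases List.mem_append.1 hx with h | h
      exacts [hL' x h, hL x h]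
    · rw [List.map_append, List.sum_append, e1, e1', List.map_cons, List.sum_cons]
      abel
    · rw [List.map_append, List.sum_append, List.map_cons, List.sum_cons, trace_add, mul_add]
      exact add_le_add e2' e2

/-- The coded vector, cut to dimension `N`. -/
def codedVec (N : ℕ) (l : List Entry) : Fin N → ℂ := fun i => (entryAt l i).val

/-- The matrix with the given Gaussian rational entries. -/
def dataMatrix (N : ℕ) (M : ℕ → ℕ → GData) : Matrix (Fin N) (Fin N) ℂ :=
  Matrix.of fun i j => (M i j).val

theorem list_sum_matrix_apply {N : ℕ} {β : Type} (l : List β)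
    (f : β → Matrix (Fin N) (Fin N) ℂ) (i j : Fin N) :
    (l.map f).sum i j = (l.map fun b => f b i j).sum := by
  induction l with
  | nil => rfl
  | cons b l ih => simp [ih]

theorem isUnitCode_iff (N : ℕ) (l : List Entry) :
    IsUnitCode N l ↔ l.length = N ∧ (rankOne (codedVec N l)).trace = 1 := by
  rw [IsUnitCode, GData.eqv_iff, GData.val_sum_range, GData.val_one, trace_rankOne]
  simp only [GData.val_mulConj, codedVec]

theorem valid_iff (N : ℕ) (M : ℕ → ℕ → GData) (w : Certificate) : w.Valid N M ↔
    (∀ r ∈ w.1, IsUnitCode N r.2 ∧ ∀ c ∈ r.2, Entry.IsCode c) ∧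
    (w.1.map fun r => (1 / 2 : ℂ) ^ r.1 • rankOne (codedVec N r.2)).sum =
      dataMatrix N M + (w.2.1.map fun u => rankOne (codedVec N u)).sum ∧
    (w.1.map fun r => (1 / 2 : ℂ) ^ r.1).sum + (w.2.2.map fun c => c.val * star c.val).sum =
      4 * (dataMatrix N M).trace := by
  have hcomp : ∀ {β : Type} (l : List β) (f : β → GData),
      (GData.sum (l.map f)).val = (l.map fun b => (f b).val).sum := fun l f => by
    rw [GData.val_sum, List.map_map]; rfl
  rw [Certificate.Valid]
  refine and_congr Iff.rfl (and_congr ?_ ?_)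
  · rw [← Matrix.ext_iff]
    constructor
    · intro h i j
      have := (GData.eqv_iff _ _).1 (h i i.2 j j.2)
      rw [GData.val_add, hcomp, hcomp] at this
      rw [Matrix.add_apply, list_sum_matrix_apply, list_sum_matrix_apply]
      simp only [GData.val_mul, GData.val_mulConj, GData.val_halfPow] at this
      exact this
    · intro h i hi j hj
      have := h ⟨i, hi⟩ ⟨j, hj⟩
      rw [Matrix.add_apply, list_sum_matrix_apply, list_sum_matrix_apply] at this
      rw [GData.eqv_iff, GData.val_add, hcomp, hcomp]
      simp only [GData.val_mul, GData.val_mulConj, GData.val_halfPow]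
      exact this
  · rw [GData.eqv_iff, GData.val_add, GData.val_mul, GData.val_four, GData.val_sum_range, hcomp,
      hcomp]
    simp only [GData.val_mulConj, GData.val_halfPow]
    rfl

open Classical in
/-- A code of a Gaussian rational number (of `0` for other numbers). -/
def numCode (z : ℂ) : Entry := if h : z ∈ gaussRat then h.choose.code else GRat.code (0, 0)

theorem isCode_numCode (z : ℂ) : (numCode z).IsCode := by
  rw [Entry.isCode_iff, numCode]
  split_ifs
  exacts [⟨_, rfl⟩, ⟨_, rfl⟩]

theorem val_numCode {z : ℂ} (h : z ∈ gaussRat) : (numCode z).val = z := by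
  rw [numCode, dif_pos h, Entry.val_code]; exact h.choose_spec

theorem entryAt_ofFn {N : ℕ} (f : Fin N → Entry) (i : Fin N) :
    (entryAt (List.ofFn f) i).val = (f i).val := by
  rw [entryAt, List.getD_eq_getElem _ _ (by simp)]
  simp [Entry.val]

theorem codedVec_numCode {N : ℕ} {v : Fin N → ℂ} (hv : ∀ i, v i ∈ gaussRat) :
    codedVec N (List.ofFn fun i => numCode (v i)) = v := by
  funext i
  rw [codedVec, entryAt_ofFn, val_numCode (hv i)]

/-- The search for a certificate therefore terminates on every rational semi-density matrix:
decompose it by Gaussian elimination, cover each rank-one term by states, and express both the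
excess and the trace defect by squares. -/
theorem exists_valid {n : ℕ} {M : ℕ → ℕ → GData} (hM : (dataMatrix (2 ^ n) M).PosSemidef)
    (h1 : (dataMatrix (2 ^ n) M).trace ≤ 1) : ∃ w : Certificate, w.Valid (2 ^ n) M := by
  obtain ⟨l, hl, e⟩ := exists_list_of_mem_rationalCone
    (mem_rationalCone_of_posSemidef hM fun i j => GData.val_mem _)
  obtain ⟨L, hL, S, hS, e1, e2⟩ := exists_states_list l hl (e ▸ h1)
  rw [← e] at e1 e2
  obtain ⟨R, hR, rfl⟩ := exists_list_of_mem_rationalCone hS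
  -- The defect is a non-negative rational, hence a sum of two squared moduli.
  obtain ⟨q, hq, hq'⟩ := exists_rat_of_nonneg (c := 4 * (dataMatrix (2 ^ n) M).trace -
      (L.map fun x => (1 / 2 : ℂ) ^ x.1).sum)
    (sub_mem (mul_mem (ofNat_mem _ _) (sum_mem fun i _ => GData.val_mem _))
      (list_sum_mem fun x hx => by
        obtain ⟨y, -, rfl⟩ := List.mem_map.1 hx
        exact half_pow_mem _)) (sub_nonneg.2 e2)
  obtain ⟨z, hz, z', hz', hzz⟩ := exists_sum_two_norms q hq
  refine ⟨(L.map fun x => (x.1, List.ofFn fun i => numCode (x.2 i)),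
    R.map fun v => List.ofFn fun i => numCode (v i), [numCode z, numCode z']), ?_⟩
  rw [valid_iff]
  refine ⟨?_, ?_, ?_⟩
  · intro r hr
    obtain ⟨x, hx, rfl⟩ := List.mem_map.1 hr
    refine ⟨(isUnitCode_iff _ _).2 ⟨by simp, ?_⟩, ?_⟩
    · rw [codedVec_numCode (hL x hx).1, (hL x hx).2]
    · intro c hc
      obtain ⟨i, rfl⟩ := (List.mem_ofFn' _ _).1 hc
      exact isCode_numCode _
  · have h1 : ∀ x ∈ L, (1 / 2 : ℂ) ^ x.1 •
        rankOne (codedVec (2 ^ n) (List.ofFn fun i => numCode (x.2 i))) =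
        (1 / 2 : ℂ) ^ x.1 • rankOne x.2 := fun x hx => by rw [codedVec_numCode (hL x hx).1]
    have h2 : ∀ v ∈ R, rankOne (codedVec (2 ^ n) (List.ofFn fun i => numCode (v i))) =
        rankOne v := fun v hv => by rw [codedVec_numCode (hR v hv)]
    simp only [List.map_map, Function.comp_def]
    rw [List.map_congr_left h1, List.map_congr_left h2]
    exact e1
  · simp only [List.map_map, List.map_cons, List.map_nil, List.sum_cons, List.sum_nil, add_zero,
      val_numCode hz, val_numCode hz', ← hzz, ← hq']
    exact add_sub_cancel _ _

/-! ## Consequences of a valid certificate -/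

theorem trace_mul_rankOne {N : ℕ} (σ : Matrix (Fin N) (Fin N) ℂ) (v : Fin N → ℂ) :
    (σ * rankOne v).trace = star v ⬝ᵥ (σ *ᵥ v) := by
  rw [rankOne, mul_vecMulVec, trace_vecMulVec, dotProduct_comm]

theorem trace_mul_rankOne_nonneg {N : ℕ} {σ : Matrix (Fin N) (Fin N) ℂ} (hσ : σ.PosSemidef)
    (v : Fin N → ℂ) : 0 ≤ (σ * rankOne v).trace.re := by
  rw [trace_mul_rankOne]
  exact (Complex.nonneg_iff.1 (hσ.dotProduct_mulVec_nonneg v)).1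

theorem ofReal_list_sum_le {β : Type} (l : List β) (f : β → ℝ) :
    ENNReal.ofReal (l.map f).sum ≤ (l.map fun b => ENNReal.ofReal (f b)).sum := by
  induction l with
  | nil => simp
  | cons b l ih =>
    simp only [List.map_cons, List.sum_cons]
    exact ENNReal.ofReal_add_le.trans (add_le_add le_rfl ih)

theorem ofReal_list_sum {β : Type} (l : List β) (f : β → ℝ) (hf : ∀ b, 0 ≤ f b) :
    ENNReal.ofReal (l.map f).sum = (l.map fun b => ENNReal.ofReal (f b)).sum := by
  induction l with
  | nil => simp
  | cons b l ih =>
    simp only [List.map_cons, List.sum_cons]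
    rw [ENNReal.ofReal_add (hf b) (List.sum_nonneg fun x hx => by
      obtain ⟨y, -, rfl⟩ := List.mem_map.1 hx; exact hf y), ih]

theorem trace_mul_list_sum_re {N : ℕ} {β : Type} (σ : Matrix (Fin N) (Fin N) ℂ) (l : List β)
    (f : β → Matrix (Fin N) (Fin N) ℂ) :
    (σ * (l.map f).sum).trace.re = (l.map fun b => (σ * f b).trace.re).sum := by
  induction l with
  | nil => simp
  | cons b l ih => simp [mul_add, ih]

/-- The excess is a sum of rank-one matrices |u⟩⟨u|, so `σ` has non-negative expectation in it and
it may be dropped. -/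
theorem ofReal_trace_le_of_valid {N : ℕ} {M : ℕ → ℕ → GData} {w : Certificate}
    (hw : w.Valid N M) {σ : Matrix (Fin N) (Fin N) ℂ} (hσ : σ.PosSemidef) :
    ENNReal.ofReal (σ * dataMatrix N M).trace.re ≤ (w.1.map fun r =>
      (2⁻¹ : ℝ≥0∞) ^ r.1 * ENNReal.ofReal (σ * rankOne (codedVec N r.2)).trace.re).sum := by
  obtain ⟨-, h, -⟩ := (valid_iff N M w).1 hw
  have h2 := congrArg (fun A => (σ * A).trace.re) h
  simp only [mul_add, trace_add, Complex.add_re] at h2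
  rw [trace_mul_list_sum_re, trace_mul_list_sum_re] at h2
  have h3 : 0 ≤ (w.2.1.map fun u => (σ * rankOne (codedVec N u)).trace.re).sum :=
    List.sum_nonneg fun x hx => by
      obtain ⟨y, -, rfl⟩ := List.mem_map.1 hx; exact trace_mul_rankOne_nonneg hσ _
  have h4 : (σ * dataMatrix N M).trace.re ≤ (w.1.map fun r =>
      (σ * ((1 / 2 : ℂ) ^ r.1 • rankOne (codedVec N r.2))).trace.re).sum := by linarith
  refine (ENNReal.ofReal_le_ofReal h4).trans ((ofReal_list_sum_le _ _).trans (le_of_eq ?_))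
  congr 1
  refine List.map_congr_left fun r _ => ?_
  rw [← ofReal_half_pow, ← ENNReal.ofReal_mul (by positivity)]
  congr 1
  rw [Matrix.mul_smul, trace_smul, smul_eq_mul]
  have : ((1 / 2 : ℂ)) ^ r.1 = (((1 / 2 : ℝ) ^ r.1 : ℝ) : ℂ) := by push_cast; rfl
  rw [this, Complex.re_ofReal_mul]

theorem sum_weights_le_of_valid {N : ℕ} {M : ℕ → ℕ → GData} {w : Certificate}
    (hw : w.Valid N M) : (w.1.map fun r => (2⁻¹ : ℝ≥0∞) ^ r.1).sum ≤
      4 * ENNReal.ofReal (dataMatrix N M).trace.re := by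
  obtain ⟨-, -, h⟩ := (valid_iff N M w).1 hw
  have h2 := congrArg Complex.re h
  rw [Complex.add_re] at h2
  have hre : ∀ {β : Type} (l : List β) (f : β → ℂ),
      (l.map f).sum.re = (l.map fun b => (f b).re).sum := fun l f => by
    induction l with
    | nil => simp
    | cons b l ih => simp [ih]
  rw [hre, hre] at h2
  have h3 : 0 ≤ (w.2.2.map fun c => (c.val * star c.val).re).sum :=
    List.sum_nonneg fun x hx => by
      obtain ⟨y, -, rfl⟩ := List.mem_map.1 hx
      exact (Complex.nonneg_iff.1 (mul_star_self_nonneg _)).1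
  have h4 : ∀ k : ℕ, (((1 / 2 : ℂ)) ^ k).re = (1 / 2 : ℝ) ^ k := fun k => by
    have : ((1 / 2 : ℂ)) ^ k = (((1 / 2 : ℝ) ^ k : ℝ) : ℂ) := by push_cast; rfl
    rw [this, Complex.ofReal_re]
  simp only [h4] at h2
  have h5 : (4 * (dataMatrix N M).trace).re = 4 * (dataMatrix N M).trace.re := by
    simp
  simp only [← ofReal_half_pow]
  rw [← ofReal_list_sum _ _ fun _ => by positivity]
  have h6 : (4 : ℝ≥0∞) = ENNReal.ofReal 4 := by simp
  rw [h6, ← ENNReal.ofReal_mul (by norm_num)]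
  exact ENNReal.ofReal_le_ofReal (by linarith)

theorem tsum_getElem?_elim {β : Type} (l : List β) (F : β → ℝ≥0∞) :
    ∑' j : ℕ, (l[j]?).elim 0 F = (l.map F).sum := by
  induction l with
  | nil => simp
  | cons b l ih =>
    rw [tsum_eq_zero_add' ENNReal.summable]
    simp [ih]

/-! ## Elementary states as vectors -/

theorem codedVec_code {n : ℕ} (φ : ElemState n) : codedVec (2 ^ n) φ.code = φ.vec := by
  funext i
  rw [codedVec, ElemState.code, entryAt_ofFn, Entry.val_code]; rfl

theorem proj_eq_rankOne {n : ℕ} (φ : ElemState n) : φ.proj = rankOne φ.vec := rfl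

theorem GRat.toComplex_mul_star (z : GRat) :
    z.toComplex * star z.toComplex = ((z.1 ^ 2 + z.2 ^ 2 : ℚ) : ℂ) := by
  have h : z.toComplex * star z.toComplex = ((Complex.normSq z.toComplex : ℝ) : ℂ) :=
    Complex.mul_conj _
  rw [h, Complex.normSq_apply]
  simp only [GRat.toComplex]
  push_cast
  ring

theorem trace_proj {n : ℕ} (φ : ElemState n) : φ.proj.trace = 1 := by
  rw [proj_eq_rankOne, trace_rankOne]
  simp only [ElemState.vec, GRat.toComplex_mul_star]
  exact_mod_cast φ.2

theorem isUnitCode_code {n : ℕ} (φ : ElemState n) : IsUnitCode (2 ^ n) φ.code := by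
  rw [isUnitCode_iff, codedVec_code]
  exact ⟨by simp [ElemState.code], trace_proj φ⟩

/-- Requiring reduced entries makes the listed vector literally the code of an elementary state, the
only strings that contribute to the universal matrix. -/
theorem exists_elemState {n : ℕ} {l : List Entry} (h1 : IsUnitCode (2 ^ n) l)
    (h2 : ∀ c ∈ l, Entry.IsCode c) : ∃ φ : ElemState n, φ.code = l := by
  obtain ⟨hlen, htr⟩ := (isUnitCode_iff _ _).1 h1
  have h3 : ∀ i : Fin (2 ^ n), ∃ z : GRat, z.code = l[i.val]'(by rw [hlen]; exact i.2) := fun i =>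
    (Entry.isCode_iff _).1 (h2 _ (List.getElem_mem _))
  choose z hz using h3
  have hl : (List.ofFn fun i => (z i).code) = l := by
    apply List.ext_getElem
    · simp [hlen]
    · intro i h1 h2
      simp [hz]
  refine ⟨⟨z, ?_⟩, hl⟩
  rw [← hl, trace_rankOne] at htr
  simp only [codedVec, entryAt_ofFn, Entry.val_code, GRat.toComplex_mul_star] at htr
  exact_mod_cast htr

theorem GRat.code_injective : Function.Injective GRat.code := by
  intro a b h
  simp only [GRat.code, Prod.mk.injEq] at h
  exact Prod.ext (Rat.ext h.1.1 h.1.2) (Rat.ext h.2.1 h.2.2)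

theorem ElemState.code_injective {n : ℕ} : Function.Injective (ElemState.code (n := n)) := by
  intro φ ψ h
  refine Subtype.ext (funext fun i => GRat.code_injective ?_)
  exact congrFun (List.ofFn_injective h) i

/-! ## Binary strings of objects -/

/-- The number with the given binary digits, least significant digit first. -/
def ofBits (l : List Bool) : ℕ := l.foldr (fun b a => b.toNat + 2 * a) 0

theorem ofBits_bits (n : ℕ) : ofBits n.bits = n := by
  induction n using Nat.binaryRec' with
  | zero => simp [ofBits]
  | bit b n h ih =>
    rw [Nat.bits_append_bit n b h, ofBits, List.foldr_cons]
    change b.toNat + 2 * ofBits n.bits = _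
    rw [ih, Nat.bit_val]
    omega

/-- The object with the given string. -/
def unstr (α : Type) [Primcodable α] (l : List Bool) : Option α := Encodable.decode (ofBits l)

theorem unstr_str {α : Type} [Primcodable α] (a : α) : unstr α (str a) = some a := by
  rw [unstr, str, ofBits_bits, Encodable.encodek]

theorem str_injective {α : Type} [Primcodable α] : Function.Injective (str (α := α)) := by
  intro a b h
  have := unstr_str a
  rw [h, unstr_str] at this
  exact (Option.some.inj this).symm

theorem primrec_unstr (α : Type) [Primcodable α] : Primrec (unstr α) := by
  refine Primrec.decode.comp ?_
  refine Primrec.list_foldr (h := fun _ (p : Bool × ℕ) => p.1.toNat + 2 * p.2)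
    Primrec.id (Primrec.const 0) ?_
  exact Primrec.nat_add.comp ((Primrec.dom_bool Bool.toNat).comp (Primrec.fst.comp Primrec.snd))
    (Primrec.nat_mul.comp (Primrec.const 2) (Primrec.snd.comp Primrec.snd))

/-- Course-of-values recursion: the digits of n are its parity followed by the digits of n / 2. -/
theorem primrec_bits : Primrec Nat.bits := by
  have h : Primrec₂ fun (_ : Unit) (n : ℕ) => n.bits := by
    refine Primrec.nat_strong_rec _ (g := fun _ (l : List (List Bool)) => some <|
      if l.length = 0 then [] else decide (l.length % 2 = 1) :: l.getD (l.length / 2) []) ?_ ?_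
    · have hl : Primrec fun p : Unit × List (List Bool) => p.2.length := by fun_prop
      have h1 : Primrec fun p : Unit × List (List Bool) => decide (p.2.length % 2 = 1) :=
        (Primrec.eq.comp (Primrec.nat_mod.comp hl (Primrec.const 2)) (Primrec.const 1)).decide
      have h2 : Primrec fun p : Unit × List (List Bool) => p.2.length / 2 :=
        Primrec.nat_div.comp hl (Primrec.const 2)
      refine Primrec.option_some.comp (Primrec.ite (Primrec.eq.comp hl (Primrec.const 0))
        (Primrec.const []) (Primrec.list_cons.comp h1 ?_))
      fun_prop
    · intro _ n
      simp only [List.length_map, List.length_range, Option.some.injEq]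
      rcases Nat.eq_zero_or_pos n with rfl | hn
      · simp
      · have h1 : n.bits = decide (n % 2 = 1) :: (n / 2).bits := by
          rcases Nat.mod_two_eq_zero_or_one n with h2 | h2
          · have h3 : n = 2 * (n / 2) := by omega
            conv_lhs => rw [h3, Nat.bit0_bits _ (by omega)]
            simp [h2]
          · have h3 : n = 2 * (n / 2) + 1 := by omega
            conv_lhs => rw [h3, Nat.bit1_bits]
            simp [h2]
        rw [if_neg hn.ne', h1, List.getD_eq_getElem _ _ (by simp; omega)]
        simp
  exact h.comp (Primrec.const ()) Primrec.id

@[fun_prop] theorem primrec_str' {α β : Type} [Primcodable α] [Primcodable β] {f : β → α}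
    (hf : Primrec f) : Primrec fun b => str (f b) :=
  primrec_bits.comp (Primrec.encode.comp hf)

/-! ## The trace of the universal matrix -/

/-- With σ = B*B the left side is ‖Bv‖² and the trace of σ is the squared Hilbert–Schmidt norm of B;
apply Cauchy–Schwarz to each row. -/
theorem trace_mul_rankOne_re_le {N : ℕ} {σ : Matrix (Fin N) (Fin N) ℂ} (hσ : σ.PosSemidef)
    (v : Fin N → ℂ) : (σ * rankOne v).trace.re ≤ σ.trace.re * (rankOne v).trace.re := by
  obtain ⟨B, rfl⟩ : ∃ B : Matrix (Fin N) (Fin N) ℂ, σ = Bᴴ * B := by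
    open scoped MatrixOrder in
    exact CStarAlgebra.nonneg_iff_eq_star_mul_self.1 hσ.nonneg
  have e : ∀ z : ℂ, (star z * z).re = ‖z‖ ^ 2 := fun z => by
    rw [Complex.star_def, Complex.conj_mul']; norm_cast
  have e' : ∀ z : ℂ, (z * star z).re = ‖z‖ ^ 2 := fun z => by rw [mul_comm, e]
  have h1 : (Bᴴ * B * rankOne v).trace.re = ∑ k, ‖(B *ᵥ v) k‖ ^ 2 := by
    rw [trace_mul_rankOne, ← mulVec_mulVec, dotProduct_mulVec, vecMul_conjTranspose, star_star,
      dotProduct, Complex.re_sum]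
    exact Finset.sum_congr rfl fun k _ => e _
  have h2 : (Bᴴ * B).trace.re = ∑ k, ∑ i, ‖B k i‖ ^ 2 := by
    rw [trace_mul_comm, Matrix.trace, Complex.re_sum]
    refine Finset.sum_congr rfl fun k _ => ?_
    rw [diag_apply, Matrix.mul_apply, Complex.re_sum]
    exact Finset.sum_congr rfl fun i _ => e' _
  have h3 : (rankOne v).trace.re = ∑ i, ‖v i‖ ^ 2 := by
    rw [trace_rankOne, Complex.re_sum]
    exact Finset.sum_congr rfl fun i _ => e' _
  rw [h1, h2, h3, Finset.sum_mul]
  refine Finset.sum_le_sum fun k _ => ?_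
  refine le_trans ?_ (Finset.sum_mul_sq_le_sq_mul_sq _ _ _)
  refine pow_le_pow_left₀ (norm_nonneg _) ?_ 2
  refine (norm_sum_le Finset.univ fun i => B k i * v i).trans (le_of_eq ?_)
  exact Finset.sum_congr rfl fun i _ => norm_mul _ _

open Classical in
/-- The expectation of `σ` in the state with the given string, `0` for other strings. -/
def stateExp {n : ℕ} (σ : QMatrix n) (z : List Bool) : ℝ≥0∞ :=
  ∑' φ : ElemState n, if str φ.code = z then ENNReal.ofReal (σ * φ.proj).trace.re else 0

theorem stateExp_str {n : ℕ} (σ : QMatrix n) (φ : ElemState n) :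
    stateExp σ (str φ.code) = ENNReal.ofReal (σ * φ.proj).trace.re := by
  classical
  rw [stateExp, tsum_eq_single φ, if_pos rfl]
  intro ψ hψ
  exact if_neg fun h => hψ (ElemState.code_injective (str_injective h))

theorem exists_of_stateExp_ne_zero {n : ℕ} {σ : QMatrix n} {z : List Bool}
    (h : stateExp σ z ≠ 0) : ∃ φ : ElemState n, z = str φ.code := by
  by_contra! hno
  refine h (ENNReal.tsum_eq_zero.2 fun φ => if_neg fun h => hno φ h.symm)

theorem tsum_mE_elemState_le_one (U : PrefixMachine) (n : ℕ) (y : List Bool) :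
    ∑' φ : ElemState n, U.mE (str φ.code) y ≤ 1 :=
  (ENNReal.tsum_comp_le_tsum_of_injective
    (str_injective.comp ElemState.code_injective) fun z => U.mE z y).trans (U.tsum_mE_le_one y)

theorem summable_m_elemState (U : PrefixMachine) (n : ℕ) (y : List Bool) :
    Summable fun φ : ElemState n => U.m (str φ.code) y := by
  simp only [PrefixMachine.m_eq_toReal]
  exact ENNReal.summable_toReal
    ((tsum_mE_elemState_le_one U n y).trans_lt ENNReal.one_lt_top).ne

theorem norm_proj_apply_le {n : ℕ} (φ : ElemState n) (i j : Fin (2 ^ n)) : ‖φ.proj i j‖ ≤ 1 := by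
  have h : ∀ i, ‖φ.vec i‖ ≤ 1 := fun i => by
    have h1 : ∑ i, ‖φ.vec i‖ ^ 2 = 1 := by
      have := congrArg Complex.re (trace_proj φ)
      rw [proj_eq_rankOne, trace_rankOne, Complex.re_sum, Complex.one_re] at this
      rw [← this]
      refine Finset.sum_congr rfl fun i _ => ?_
      rw [Complex.star_def, Complex.mul_conj']; norm_cast
    have h2 : ‖φ.vec i‖ ^ 2 ≤ 1 := h1 ▸
      Finset.single_le_sum (f := fun i => ‖φ.vec i‖ ^ 2) (fun i _ => by positivity)
        (Finset.mem_univ i)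
    exact (sq_le_one_iff₀ (norm_nonneg _)).1 h2
  rw [proj_eq_rankOne, rankOne_apply, norm_mul, norm_star]
  exact mul_le_one₀ (h i) (norm_nonneg _) (h j)

/-- Entries of a projection are bounded by 1, so the universal probabilities are a summable majorant
for each entry. -/
theorem summable_universalMatrix (U : PrefixMachine) (n : ℕ) (x : List Bool) :
    Summable fun φ : ElemState n =>
      ((U.m (str φ.code) (str (x, n)) : ℝ) : ℂ) • φ.proj := by
  refine Pi.summable.2 fun i => Pi.summable.2 fun j => ?_
  refine Summable.of_norm_bounded (summable_m_elemState U n (str (x, n))) fun φ => ?_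
  rw [Matrix.smul_apply, smul_eq_mul, norm_mul, Complex.norm_real,
    Real.norm_of_nonneg (U.m_nonneg _ _)]
  exact mul_le_of_le_one_right (U.m_nonneg _ _) (norm_proj_apply_le φ i j)

/-- Taking the trace against `σ` is continuous and additive, so it passes through the series.
Indexing the result by all strings lets it be compared with sums over programs. -/
theorem trace_universalMatrix (U : PrefixMachine) {n : ℕ} {σ : QMatrix n} (hσ : σ.PosSemidef)
    (x : List Bool) : 0 ≤ (universalMatrix U n x * σ).trace.re ∧
      ENNReal.ofReal (universalMatrix U n x * σ).trace.re =
        ∑' z, U.mE z (str (x, n)) * stateExp σ z := by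
  classical
  let ℓ : QMatrix n →+ ℝ :=
    { toFun := fun A => (A * σ).trace.re
      map_zero' := by simp
      map_add' := fun A B => by simp [add_mul] }
  have hℓ : Continuous ℓ :=
    Complex.continuous_re.comp ((continuous_id.matrix_mul continuous_const).matrix_trace)
  have hs := (summable_universalMatrix U n x).hasSum.map ℓ hℓ
  have hterm : ∀ φ : ElemState n, ℓ (((U.m (str φ.code) (str (x, n)) : ℝ) : ℂ) • φ.proj) =
      U.m (str φ.code) (str (x, n)) * (σ * φ.proj).trace.re := fun φ => by
    change ((((U.m (str φ.code) (str (x, n)) : ℝ) : ℂ) • φ.proj) * σ).trace.re = _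
    rw [Matrix.smul_mul, trace_smul, smul_eq_mul, Complex.re_ofReal_mul, trace_mul_comm]
  have hnn : ∀ φ : ElemState n,
      0 ≤ U.m (str φ.code) (str (x, n)) * (σ * φ.proj).trace.re := fun φ =>
    mul_nonneg (U.m_nonneg _ _) (trace_mul_rankOne_nonneg hσ _)
  have hs' : HasSum (fun φ : ElemState n =>
      U.m (str φ.code) (str (x, n)) * (σ * φ.proj).trace.re)
      (universalMatrix U n x * σ).trace.re := by
    have := hs
    simp only [Function.comp_def, hterm] at this
    exact this
  refine ⟨hs'.nonneg hnn, ?_⟩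
  rw [← hs'.tsum_eq, ENNReal.ofReal_tsum_of_nonneg hnn hs'.summable]
  simp only [stateExp, ← ENNReal.tsum_mul_left]
  rw [ENNReal.tsum_comm]
  refine tsum_congr fun φ => ?_
  rw [tsum_eq_single (str φ.code), if_pos rfl, ENNReal.ofReal_mul (U.m_nonneg _ _), U.ofReal_m]
  intro z hz
  rw [if_neg (Ne.symm hz), mul_zero]

theorem stateExp_le_one {n : ℕ} {σ : QMatrix n} (hσ : IsSemiDensity σ) (z : List Bool) :
    stateExp σ z ≤ 1 := by
  by_cases h : stateExp σ z = 0
  · simp [h]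
  · obtain ⟨φ, rfl⟩ := exists_of_stateExp_ne_zero h
    rw [stateExp_str, ENNReal.ofReal_le_one]
    refine (trace_mul_rankOne_re_le hσ.1 _).trans ?_
    rw [← proj_eq_rankOne, trace_proj, Complex.one_re, mul_one]
    exact hσ.2

theorem trace_universalMatrix_le_one (U : PrefixMachine) {n : ℕ} {σ : QMatrix n}
    (hσ : IsSemiDensity σ) (x : List Bool) : (universalMatrix U n x * σ).trace.re ≤ 1 := by
  rw [← ENNReal.ofReal_le_one, (trace_universalMatrix U hσ.1 x).2]
  refine le_trans (ENNReal.tsum_le_tsum fun z => ?_) (U.tsum_mE_le_one (str (x, n)))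
  exact mul_le_of_le_one_right zero_le (stateExp_le_one hσ z)

/-! ## Reduced matrices of a vector on `2n` qubits -/

/-- The entries of the second marginal `∑_i |Φ_i⟩⟨Φ_i|` of `Φ = ∑_i |i⟩ ⊗ |Φ_i⟩`. -/
def marginal (N : ℕ) (Φ : List Entry) (a b : ℕ) : GData :=
  GData.sum ((List.range N).map fun i => (entryAt Φ (N * i + a)).mulConj (entryAt Φ (N * i + b)))

/-- The entries of the partial trace over the second factor of `|Φ⟩⟨Φ| (1 ⊗ ρ)`. -/
def weightedMarginal (N : ℕ) (ρ : List (List Entry)) (Φ : List Entry) (a b : ℕ) : GData :=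
  GData.sum ((List.range N).map fun j => GData.sum ((List.range N).map fun k =>
    (entryAt (ρ.getD j []) k).mul
      ((entryAt Φ (N * a + k)).mulConj (entryAt Φ (N * b + j)))))

/-- The coefficients of a coded vector as an `N × N` matrix. -/
def coeffMatrix (N : ℕ) (Φ : List Entry) : Matrix (Fin N) (Fin N) ℂ :=
  Matrix.of fun i j => (entryAt Φ (N * i + j)).val

theorem dataMatrix_marginal (N : ℕ) (Φ : List Entry) :
    dataMatrix N (marginal N Φ) = (coeffMatrix N Φ)ᵀ * ((coeffMatrix N Φ)ᵀ)ᴴ := by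
  ext a b
  rw [Matrix.mul_apply]
  simp only [dataMatrix, of_apply, marginal, GData.val_sum_range, GData.val_mulConj,
    transpose_apply, conjTranspose_apply, coeffMatrix]

theorem dataMatrix_marginal_eq_sum (N : ℕ) (Φ : List Entry) :
    dataMatrix N (marginal N Φ) = ∑ i, rankOne (coeffMatrix N Φ i) := by
  ext a b
  rw [Matrix.sum_apply]
  simp only [dataMatrix, of_apply, marginal, GData.val_sum_range, GData.val_mulConj,
    coeffMatrix, rankOne_apply]

theorem entryAt_code {n : ℕ} (ρ : ElemMatrix n) (j k : Fin (2 ^ n)) :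
    (entryAt (ρ.code.getD j []) k).val = ρ.toQ j k := by
  rw [ElemMatrix.code, List.getD_eq_getElem _ _ (by simp), List.getElem_ofFn, entryAt_ofFn,
    Entry.val_code]
  rfl

/-- In this form positivity is inherited from ρ by congruence. -/
theorem dataMatrix_weightedMarginal {n : ℕ} (ρ : ElemMatrix n) (Φ : List Entry) :
    dataMatrix (2 ^ n) (weightedMarginal (2 ^ n) ρ.code Φ) =
      coeffMatrix (2 ^ n) Φ * ρ.toQᵀ * (coeffMatrix (2 ^ n) Φ)ᴴ := by
  ext a b
  simp only [Matrix.mul_apply, dataMatrix, of_apply, weightedMarginal, GData.val_sum_range,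
    GData.val_mul, GData.val_mulConj, entryAt_code, transpose_apply, conjTranspose_apply,
    coeffMatrix, Finset.sum_mul]
  refine Finset.sum_congr rfl fun j _ => Finset.sum_congr rfl fun k _ => ?_
  ring

theorem posSemidef_marginal (N : ℕ) (Φ : List Entry) :
    (dataMatrix N (marginal N Φ)).PosSemidef := by
  rw [dataMatrix_marginal]; exact posSemidef_self_mul_conjTranspose _

theorem posSemidef_weightedMarginal {n : ℕ} {ρ : ElemMatrix n} (hρ : ρ.toQ.PosSemidef)
    (Φ : List Entry) :
    (dataMatrix (2 ^ n) (weightedMarginal (2 ^ n) ρ.code Φ)).PosSemidef := by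
  rw [dataMatrix_weightedMarginal]; exact hρ.transpose.mul_mul_conjTranspose_same _

/-- This identity joins the two dominations: the weight spent on the matrices paired with σ equals
the expectation of ρ in the marginals, which H(ρ) controls. -/
theorem trace_weightedMarginal {n : ℕ} (ρ : ElemMatrix n) (Φ : List Entry) :
    (dataMatrix (2 ^ n) (weightedMarginal (2 ^ n) ρ.code Φ)).trace =
      (ρ.toQ * dataMatrix (2 ^ n) (marginal (2 ^ n) Φ)).trace := by
  rw [dataMatrix_weightedMarginal, dataMatrix_marginal]
  conv_lhs => rw [← trace_transpose]
  rw [transpose_mul, transpose_mul, transpose_transpose, trace_mul_comm, Matrix.mul_assoc]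
  rfl

theorem trace_marginal {n : ℕ} {Φ : List Entry} (h : IsUnitCode (2 ^ (n + n)) Φ) :
    (dataMatrix (2 ^ n) (marginal (2 ^ n) Φ)).trace = 1 := by
  rw [← ((isUnitCode_iff _ _).1 h).2, trace_rankOne, dataMatrix_marginal_eq_sum, trace_sum]
  simp only [trace_rankOne]
  rw [← Equiv.sum_comp (finProdFinEquiv.trans (finCongr (pow_add 2 n n).symm)),
    Fintype.sum_prod_type]
  refine Finset.sum_congr rfl fun i _ => Finset.sum_congr rfl fun j _ => ?_
  simp [codedVec, coeffMatrix, add_comm]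

theorem trace_weightedMarginal_re_le_one {n : ℕ} {ρ : ElemMatrix n} (hρ : IsSemiDensity ρ.toQ)
    {Φ : List Entry} (h : IsUnitCode (2 ^ (n + n)) Φ) :
    (dataMatrix (2 ^ n) (weightedMarginal (2 ^ n) ρ.code Φ)).trace.re ≤ 1 := by
  have h1 := trace_marginal h
  rw [dataMatrix_marginal_eq_sum, trace_sum] at h1
  rw [trace_weightedMarginal, dataMatrix_marginal_eq_sum, Matrix.mul_sum, trace_sum,
    Complex.re_sum]
  calc _ ≤ ∑ i, ρ.toQ.trace.re * (rankOne (coeffMatrix (2 ^ n) Φ i)).trace.re :=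
        Finset.sum_le_sum fun i _ => trace_mul_rankOne_re_le hρ.1 _
    _ = ρ.toQ.trace.re := by
        rw [← Finset.mul_sum, ← Complex.re_sum, h1, Complex.one_re, mul_one]
    _ ≤ 1 := hρ.2

theorem posSemidef_tensor {n k : ℕ} {A : QMatrix n} {B : QMatrix k} (hA : A.PosSemidef)
    (hB : B.PosSemidef) : (tensor A B).PosSemidef :=
  (hA.kronecker hB).submatrix _

theorem trace_tensor_mul_proj {n : ℕ} (σ : QMatrix n) (ρ : ElemMatrix n) (φ : ElemState (n + n)) :
    (tensor σ ρ.toQ * φ.proj).trace =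
      (σ * dataMatrix (2 ^ n) (weightedMarginal (2 ^ n) ρ.code φ.code)).trace := by
  have hc : ∀ i j, coeffMatrix (2 ^ n) φ.code i j =
      φ.vec (finProdFinEquiv.trans (finCongr (pow_add 2 n n).symm) (i, j)) := fun i j => by
    rw [← codedVec_code]
    simp [codedVec, coeffMatrix, add_comm]
  have ht : ∀ a b, tensor σ ρ.toQ (finProdFinEquiv.trans (finCongr (pow_add 2 n n).symm) a)
      (finProdFinEquiv.trans (finCongr (pow_add 2 n n).symm) b) =
      σ a.1 b.1 * ρ.toQ a.2 b.2 := fun a b => by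
    rw [tensor, reindex_apply, submatrix_apply, Equiv.symm_apply_apply, Equiv.symm_apply_apply]
    rfl
  rw [proj_eq_rankOne, trace_mul_rankOne, dataMatrix_weightedMarginal]
  simp only [Matrix.trace, diag_apply, Matrix.mul_apply, dotProduct, mulVec, conjTranspose_apply,
    transpose_apply, hc]
  generalize finProdFinEquiv.trans (finCongr (pow_add 2 n n).symm) = e at ht ⊢
  rw [← e.sum_comp, Fintype.sum_prod_type]
  refine Finset.sum_congr rfl fun i _ => ?_
  simp only [← e.sum_comp (fun y => tensor σ ρ.toQ _ y * φ.vec y), ht, Fintype.sum_prod_type,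
    Finset.mul_sum, Finset.sum_mul, Pi.star_apply]
  rw [Finset.sum_comm]
  refine Finset.sum_congr rfl fun a _ => Finset.sum_congr rfl fun j _ =>
    Finset.sum_congr rfl fun k _ => ?_
  ring

/-! ## Sums over partial values -/

theorem partElim_bind {β γ : Type} (o : Part β) (f : β → Part γ) (F : γ → ℝ≥0∞) :
    partElim (o.bind f) F = partElim o fun b => partElim (f b) F := by
  by_cases h : o.Dom
  · obtain ⟨b, hb⟩ := Part.dom_iff_mem.1 h
    rw [partElim_of_mem hb, Part.eq_some_iff.2 hb, Part.bind_some]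
  · rw [partElim_of_not_dom h, Part.eq_none_iff'.2 h, Part.bind_none,
      partElim_of_not_dom Part.not_none_dom]

theorem partElim_map {β γ : Type} (o : Part β) (f : β → γ) (F : γ → ℝ≥0∞) :
    partElim (o.map f) F = partElim o fun b => F (f b) := by
  rw [← Part.bind_some_eq_map, partElim_bind]
  congr 1
  funext b
  exact partElim_of_mem (Part.mem_some _) F

theorem partElim_ofOption {β : Type} (o : Option β) (F : β → ℝ≥0∞) :
    partElim (Part.ofOption o) F = o.elim 0 F := by
  cases o with
  | none => exact partElim_of_not_dom Part.not_none_dom F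
  | some b => exact partElim_of_mem (Part.mem_some _) F

theorem tsum_partElim {β ι : Type} (o : Part β) (F : ι → β → ℝ≥0∞) :
    ∑' i, partElim o (F i) = partElim o fun b => ∑' i, F i b := by
  by_cases h : o.Dom
  · obtain ⟨b, hb⟩ := Part.dom_iff_mem.1 h
    simp only [partElim_of_mem hb]
  · simp only [partElim_of_not_dom h, tsum_zero]

theorem partElim_mono {β : Type} {o : Part β} {F G : β → ℝ≥0∞} (h : ∀ b ∈ o, F b ≤ G b) :
    partElim o F ≤ partElim o G := by
  by_cases hd : o.Dom
  · obtain ⟨b, hb⟩ := Part.dom_iff_mem.1 hd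
    rw [partElim_of_mem hb, partElim_of_mem hb]
    exact h b hb
  · rw [partElim_of_not_dom hd]; exact zero_le

theorem partElim_const_mul {β : Type} (o : Part β) (c : ℝ≥0∞) (F : β → ℝ≥0∞) :
    partElim o (fun b => c * F b) = c * partElim o F := by
  by_cases hd : o.Dom
  · obtain ⟨b, hb⟩ := Part.dom_iff_mem.1 hd
    rw [partElim_of_mem hb, partElim_of_mem hb]
  · rw [partElim_of_not_dom hd, partElim_of_not_dom hd, mul_zero]

/-- `decode₂` accepts only the number that encodes an object, so every object is counted exactly
once. -/
theorem tsum_decode₂ {β : Type} [Encodable β] (F : β → ℝ≥0∞) :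
    ∑' k, (Encodable.decode₂ β k).elim 0 F = ∑' b, F b := by
  classical
  rw [← (Encodable.encode_injective (α := β)).tsum_eq]
  · refine tsum_congr fun b => ?_
    rw [Encodable.encodek₂]; rfl
  · intro k hk
    rw [Function.mem_support] at hk
    cases h : Encodable.decode₂ β k with
    | none => rw [h] at hk; exact absurd rfl hk
    | some b => exact ⟨b, Encodable.mem_decode₂.1 h⟩

theorem primrec_decode₂ (β : Type) [Primcodable β] : Primrec (Encodable.decode₂ β) := by
  classical
  refine Primrec.option_bind Primrec.decode ?_
  refine Primrec.option_guard (p := fun (a : ℕ × β) (b : β) => Encodable.encode b = a.1) ?_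
    Primrec.snd
  exact Primrec.eq.comp (Primrec.encode.comp Primrec.snd) (Primrec.fst.comp Primrec.fst)

/-! ## Programs for states and their decompositions -/

open Classical in
/-- The unit vector on `2n` qubits that the program `p` produces from the condition `n + n`. -/
def unitRun (U : PrefixMachine) (n : ℕ) (p : List Bool) : Part (List Entry) :=
  (U.run p (str (([] : List Bool), n + n))).bind fun s =>
    Part.ofOption ((unstr (List Entry) s).bind fun Φ =>
      if IsUnitCode (2 ^ (n + n)) Φ then some Φ else none)

theorem isUnitCode_of_mem_unitRun {U : PrefixMachine} {n : ℕ} {p : List Bool} {Φ : List Entry}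
    (h : Φ ∈ unitRun U n p) : IsUnitCode (2 ^ (n + n)) Φ := by
  obtain ⟨s, -, h2⟩ := Part.mem_bind_iff.1 h
  rw [Part.mem_ofOption, Option.mem_def, Option.bind_eq_some_iff] at h2
  obtain ⟨Φ', -, h3⟩ := h2
  split_ifs at h3 with h4
  exact Option.some.inj h3 ▸ h4

theorem unitRun_dom {U : PrefixMachine} {n : ℕ} {p : List Bool} (h : (unitRun U n p).Dom) :
    (U.run p (str (([] : List Bool), n + n))).Dom := by
  obtain ⟨Φ, hΦ⟩ := Part.dom_iff_mem.1 h
  obtain ⟨s, hs, -⟩ := Part.mem_bind_iff.1 hΦ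
  exact Part.dom_iff_mem.2 ⟨s, hs⟩

theorem mem_unitRun_of_code {U : PrefixMachine} {n : ℕ} {p : List Bool} {φ : ElemState (n + n)}
    (h : str φ.code ∈ U.run p (str (([] : List Bool), n + n))) : φ.code ∈ unitRun U n p := by
  refine Part.mem_bind h ?_
  have : unstr (List Entry) (str φ.code) = some φ.code := unstr_str _
  rw [this, Option.bind_some, if_pos (isUnitCode_code φ)]
  exact Part.mem_some _

/-- The weighted states that dominate the matrix derived from the vector that `p` produces. -/
def statesOf (U : PrefixMachine) (n : ℕ) (M : List Entry → ℕ → ℕ → GData) (p : List Bool) :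
    Part (List (ℕ × List Entry)) :=
  (unitRun U n p).bind fun Φ => (findCertificate (2 ^ n) (M Φ)).map Prod.fst


/-- The requests for the states in the decompositions of all programs, with the weights multiplied
by `2^{h - c}`. -/
def request {α : Type} (U : PrefixMachine) (par : List Bool → Option α) (n h : α → ℕ) (c : ℕ)
    (M : α → List Entry → ℕ → ℕ → GData) (y : List Bool) (t : ℕ) : Part (List Bool × ℕ) :=
  (Part.ofOption (par y)).bind fun a =>
    (Part.ofOption (Encodable.decode₂ (List Bool) t.unpair.1)).bind fun p =>
      (statesOf U (n a) (M a) p).bind fun L =>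
        Part.ofOption ((L[t.unpair.2]?).map fun r => (str r.2, r.1 + p.length + c - h a))

theorem tsum_request {α : Type} (U : PrefixMachine) {par : List Bool → Option α} (n h : α → ℕ) (c : ℕ)
    (M : α → List Entry → ℕ → ℕ → GData) {y : List Bool} {a : α} (ha : par y = some a)
    (F : List Bool × ℕ → ℝ≥0∞) : ∑' t, partElim (request U par n h c M y t) F =
      ∑' p : List Bool, partElim (statesOf U (n a) (M a) p) fun L =>
        (L.map fun r => F (str r.2, r.1 + p.length + c - h a)).sum := by
  rw [← Nat.pairEquiv.tsum_eq, ENNReal.tsum_prod']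
  refine Eq.trans ?_ (tsum_decode₂ _)
  refine tsum_congr fun k => ?_
  simp only [Nat.pairEquiv_apply, Function.uncurry_apply_pair, request, ha, Nat.unpair_pair,
    partElim_bind, partElim_ofOption, Option.elim_some]
  cases Encodable.decode₂ (List Bool) k with
  | none => simp
  | some p =>
    simp only [Option.elim_some]
    rw [tsum_partElim]
    congr 1
    funext L
    rw [← tsum_getElem?_elim]
    refine tsum_congr fun j => ?_
    cases L[j]? <;> rfl

section Machine

variable {α : Type} [Primcodable α]

theorem partrec_unitRun (U : PrefixMachine) {n : α → ℕ} (hn : Primrec n) :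
    Partrec₂ fun (a : α) (p : List Bool) => unitRun U (n a) p := by
  classical
  have h1 : Partrec fun q : α × List Bool =>
      U.run q.2 (str (([] : List Bool), n q.1 + n q.1)) :=
    U.partrec.comp (f := fun a : List Bool × List Bool => U.run a.1 a.2)
      (g := fun q : α × List Bool => (q.2, str (([] : List Bool), n q.1 + n q.1)))
      (Primrec.to_comp (by fun_prop))
  refine Partrec.bind h1 (Computable.ofOption (Primrec.to_comp ?_))
  refine Primrec.option_bind ((primrec_unstr _).comp Primrec.snd) ?_
  exact Primrec.ite (primrecPred_isUnitCode (by fun_prop) Primrec.snd)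
    (Primrec.option_some.comp Primrec.snd) (Primrec.const none)

theorem partrec_findCertificate_fst {n : α → ℕ} (hn : Primrec n)
    {M : α → List Entry → ℕ → ℕ → GData}
    (hM : Primrec fun q : (α × List Entry) × ℕ × ℕ => M q.1.1 q.1.2 q.2.1 q.2.2) :
    Partrec fun q : α × List Entry => (findCertificate (2 ^ n q.1) (M q.1 q.2)).map Prod.fst := by
  have h1 := partrec_findCertificate (α := α × List Entry) (N := fun q => 2 ^ n q.1)
    (M := fun q => M q.1 q.2) (by fun_prop) hM
  have hg : Computable₂ fun (_ : α × List Entry) (w : Certificate) => w.1 :=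
    Computable.fst.comp Computable.snd
  exact Partrec.map h1 hg

theorem partrec_statesOf (U : PrefixMachine) {n : α → ℕ} (hn : Primrec n)
    {M : α → List Entry → ℕ → ℕ → GData}
    (hM : Primrec fun q : (α × List Entry) × ℕ × ℕ => M q.1.1 q.1.2 q.2.1 q.2.2) :
    Partrec₂ fun (a : α) (p : List Bool) => statesOf U (n a) (M a) p := by
  have hp : Computable fun q : (α × List Bool) × List Entry => (q.1.1, q.2) :=
    (Computable.fst.comp Computable.fst).pair Computable.snd
  have h := (partrec_findCertificate_fst hn hM).comp hp
  exact Partrec.bind (partrec_unitRun U hn) h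

theorem partrec_request (U : PrefixMachine) {par : List Bool → Option α} (hpar : Primrec par)
    {n h : α → ℕ} (hn : Primrec n) (hh : Primrec h) (c : ℕ) {M : α → List Entry → ℕ → ℕ → GData}
    (hM : Primrec fun q : (α × List Entry) × ℕ × ℕ => M q.1.1 q.1.2 q.2.1 q.2.2) :
    Partrec₂ (request U par n h c M) := by
  refine Partrec.bind (Computable.ofOption (hpar.comp Primrec.fst).to_comp) ?_
  refine Partrec.bind (f := fun q : (List Bool × ℕ) × α =>
    Part.ofOption (Encodable.decode₂ (List Bool) q.1.2.unpair.1))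
    (Computable.ofOption (Primrec.to_comp ((primrec_decode₂ _).comp (Primrec.fst.comp
      (Primrec.unpair.comp (Primrec.snd.comp Primrec.fst)))))) ?_
  refine Partrec.bind (f := fun q : ((List Bool × ℕ) × α) × List Bool =>
    statesOf U (n q.1.2) (M q.1.2) q.2) ?_ ?_
  · exact (partrec_statesOf U hn hM).comp (Primrec.to_comp (by fun_prop))
      (Primrec.to_comp (by fun_prop))
  · refine Computable.ofOption (Primrec.to_comp ?_)
    refine Primrec.option_map (Primrec.list_getElem?.comp Primrec.snd (Primrec.snd.comp
      (Primrec.unpair.comp (Primrec.snd.comp (Primrec.fst.comp (Primrec.fst.comp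
        Primrec.fst)))))) ?_
    have : Primrec fun q : ((((List Bool × ℕ) × α) × List Bool) × List (ℕ × List Entry)) ×
        (ℕ × List Entry) => (str q.2.2, q.2.1 + q.1.1.2.length + c - h q.1.1.1.2) := by fun_prop
    exact this

/-- Truncated subtraction only makes the left side smaller, so the total weight of requests can be
bounded without first excluding truncation. -/
theorem half_pow_sub_le (k h : ℕ) : (2⁻¹ : ℝ≥0∞) ^ (k - h) ≤ 2 ^ h * 2⁻¹ ^ k := by
  have h1 : (2 : ℝ≥0∞) ^ h * 2⁻¹ ^ h = 1 := by
    rw [← mul_pow, ENNReal.mul_inv_cancel (by simp) (by simp), one_pow]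
  rcases le_total h k with hle | hle
  · obtain ⟨d, rfl⟩ := Nat.exists_eq_add_of_le hle
    rw [Nat.add_sub_cancel_left, pow_add, ← mul_assoc, h1, one_mul]
  · obtain ⟨d, rfl⟩ := Nat.exists_eq_add_of_le hle
    have h2 : (2 : ℝ≥0∞) ^ k * 2⁻¹ ^ k = 1 := by
      rw [← mul_pow, ENNReal.mul_inv_cancel (by simp) (by simp), one_pow]
    rw [Nat.sub_eq_zero_of_le hle, pow_zero, pow_add, mul_right_comm, h2, one_mul]
    exact one_le_pow₀ one_le_two

/-- If the total weight of the decompositions is at most `2^{c - h}`, then the universal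
probability dominates them up to the factor `2^{c - h}` and a constant. -/
theorem PrefixMachine.IsUniversal.dominates {U : PrefixMachine} (hU : U.IsUniversal)
    {par : List Bool → Option α} (hpar : Primrec par) {n h : α → ℕ} (hn : Primrec n)
    (hh : Primrec h) (c : ℕ) {M : α → List Entry → ℕ → ℕ → GData}
    (hM : Primrec fun q : (α × List Entry) × ℕ × ℕ => M q.1.1 q.1.2 q.2.1 q.2.2) :
    ∃ C : ℕ, ∀ y a, par y = some a →
      ∑' p : List Bool, partElim (statesOf U (n a) (M a) p) (fun L =>
        (L.map fun r => (2⁻¹ : ℝ≥0∞) ^ (r.1 + p.length)).sum) ≤ 2 ^ c * 2⁻¹ ^ h a →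
      ∀ F : List Bool → ℝ≥0∞, ∑' p : List Bool, partElim (statesOf U (n a) (M a) p) (fun L =>
        (L.map fun r => (2⁻¹ : ℝ≥0∞) ^ (r.1 + p.length) * F (str r.2)).sum) ≤
        2 ^ C * 2⁻¹ ^ h a * ∑' x, U.mE x y * F x := by
  classical
  obtain ⟨C, hC⟩ := hU.coding (partrec_request U hpar hn hh c hM)
  refine ⟨c + C, fun y a ha hle F => ?_⟩
  have inv_mul : ∀ k : ℕ, (2 : ℝ≥0∞) ^ k * 2⁻¹ ^ k = 1 := fun k => by
    rw [← mul_pow, ENNReal.mul_inv_cancel (by simp) (by simp), one_pow]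
  have htot : ∑' t, partElim (request U par n h c M y t) (fun r => (2⁻¹ : ℝ≥0∞) ^ r.2) ≤ 1 := by
    rw [tsum_request U n h c M ha]
    have h1 : ∀ p : List Bool, partElim (statesOf U (n a) (M a) p) (fun L =>
        (L.map fun r => (2⁻¹ : ℝ≥0∞) ^ (r.1 + p.length + c - h a)).sum) ≤
        (2 ^ h a * 2⁻¹ ^ c) * partElim (statesOf U (n a) (M a) p) (fun L =>
        (L.map fun r => (2⁻¹ : ℝ≥0∞) ^ (r.1 + p.length)).sum) := fun p => by
      rw [← partElim_const_mul]
      refine partElim_mono fun L _ => ?_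
      rw [← List.sum_map_mul_left]
      refine List.sum_le_sum fun r _ => (half_pow_sub_le _ _).trans (le_of_eq ?_)
      rw [pow_add _ _ c]; ring
    refine (ENNReal.tsum_le_tsum h1).trans ?_
    rw [ENNReal.tsum_mul_left]
    refine (mul_le_mul_right hle _).trans (le_of_eq ?_)
    calc (2 : ℝ≥0∞) ^ h a * 2⁻¹ ^ c * (2 ^ c * 2⁻¹ ^ h a) =
          (2 ^ h a * 2⁻¹ ^ h a) * (2 ^ c * 2⁻¹ ^ c) := by ring
      _ = 1 := by rw [inv_mul, inv_mul, one_mul]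
  -- The hypothesis bounds every single weight by 2^{c-h}, so the exponent `r.1 + p.length + c - h
  -- a` is not truncated and the scaling is exact.
  have hexp : ∀ p : List Bool, ∀ L ∈ statesOf U (n a) (M a) p, ∀ r ∈ L,
      (2⁻¹ : ℝ≥0∞) ^ (r.1 + p.length) =
        2 ^ c * 2⁻¹ ^ h a * 2⁻¹ ^ (r.1 + p.length + c - h a) := by
    intro p L hL r hr
    have h1 : (2⁻¹ : ℝ≥0∞) ^ (r.1 + p.length) ≤ 2 ^ c * 2⁻¹ ^ h a := by
      refine le_trans ?_ hle
      refine le_trans ?_ (ENNReal.le_tsum p)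
      rw [partElim_of_mem hL]
      exact List.single_le_sum (fun _ _ => zero_le) _ (List.mem_map.2 ⟨r, hr, rfl⟩)
    have h2 : h a ≤ r.1 + p.length + c := by
      by_contra! hlt
      have h3 := mul_le_mul_right h1 ((2 : ℝ≥0∞) ^ h a * 2⁻¹ ^ c)
      have h4 : (2 : ℝ≥0∞) ^ h a * 2⁻¹ ^ c * (2 ^ c * 2⁻¹ ^ h a) = 1 := by
        calc _ = ((2 : ℝ≥0∞) ^ h a * 2⁻¹ ^ h a) * (2 ^ c * 2⁻¹ ^ c) := by ring
          _ = 1 := by rw [inv_mul, inv_mul, one_mul]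
      obtain ⟨d, hd⟩ := Nat.exists_eq_add_of_lt hlt
      have h5 : (2 : ℝ≥0∞) ^ h a * 2⁻¹ ^ c * 2⁻¹ ^ (r.1 + p.length) = 2 ^ (d + 1) := by
        rw [hd]
        calc _ = ((2 : ℝ≥0∞) ^ c * 2⁻¹ ^ c) *
              (2 ^ (r.1 + p.length) * 2⁻¹ ^ (r.1 + p.length)) * 2 ^ (d + 1) := by ring
          _ = _ := by rw [inv_mul, inv_mul, one_mul, one_mul]
      rw [h4, h5] at h3
      have h6 : (1 : ℝ≥0∞) < 2 ^ (d + 1) :=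
        ENNReal.one_lt_two.trans_le (le_self_pow₀ one_le_two (Nat.succ_ne_zero d))
      exact absurd h3 h6.not_ge
    obtain ⟨d, hd⟩ := Nat.exists_eq_add_of_le h2
    rw [hd, Nat.add_sub_cancel_left]
    calc (2⁻¹ : ℝ≥0∞) ^ (r.1 + p.length) =
          (2 ^ c * 2⁻¹ ^ c) * 2⁻¹ ^ (r.1 + p.length) := by rw [inv_mul, one_mul]
      _ = 2 ^ c * 2⁻¹ ^ (r.1 + p.length + c) := by rw [pow_add]; ring
      _ = _ := by rw [hd, pow_add]; ring
  have h1 : ∑' p : List Bool, partElim (statesOf U (n a) (M a) p) (fun L =>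
        (L.map fun r => (2⁻¹ : ℝ≥0∞) ^ (r.1 + p.length) * F (str r.2)).sum) ≤
      2 ^ c * 2⁻¹ ^ h a * ∑' t, partElim (request U par n h c M y t)
        (fun r => (2⁻¹ : ℝ≥0∞) ^ r.2 * F r.1) := by
    rw [tsum_request U n h c M ha, ← ENNReal.tsum_mul_left]
    refine ENNReal.tsum_le_tsum fun p => ?_
    rw [← partElim_const_mul]
    refine partElim_mono fun L hL => ?_
    rw [← List.sum_map_mul_left]
    refine List.sum_le_sum fun r hr => le_of_eq ?_
    rw [hexp p L hL r hr, mul_assoc]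
  refine h1.trans ?_
  -- Group the requests by the requested string, to which the coding theorem applies.
  have h2 : ∑' t, partElim (request U par n h c M y t) (fun r => (2⁻¹ : ℝ≥0∞) ^ r.2 * F r.1) =
      ∑' x, (∑' t, partElim (request U par n h c M y t)
        (fun r => if r.1 = x then (2⁻¹ : ℝ≥0∞) ^ r.2 else 0)) * F x := by
    simp only [← ENNReal.tsum_mul_right]
    rw [ENNReal.tsum_comm]
    refine tsum_congr fun t => ?_
    simp only [mul_comm _ (F _), ← partElim_const_mul]
    rw [tsum_partElim]
    congr 1
    funext r
    rw [tsum_eq_single r.1, if_pos rfl]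
    intro x hx
    rw [if_neg hx.symm, mul_zero]
  rw [h2]
  calc _ ≤ 2 ^ c * 2⁻¹ ^ h a * ∑' x, (2 ^ C * U.mE x y) * F x := by
        gcongr with x
        exact hC y htot x
    _ = _ := by
        simp only [mul_assoc]
        rw [ENNReal.tsum_mul_left, pow_add]
        ring

end Machine

/-! ## The two dominations -/

/-- Strings requested from a valid certificate name elementary states, so no expectation is lost in
passing from vectors to strings. -/
theorem stateExp_of_valid {n : ℕ} (σ : QMatrix n) {M : ℕ → ℕ → GData} {w : Certificate}
    (hw : w.Valid (2 ^ n) M) {r : ℕ × List Entry} (hr : r ∈ w.1) :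
    stateExp σ (str r.2) = ENNReal.ofReal (σ * rankOne (codedVec (2 ^ n) r.2)).trace.re := by
  obtain ⟨h1, h2⟩ := hw.1 r hr
  obtain ⟨φ, hφ⟩ := exists_elemState h1 h2
  rw [← hφ, stateExp_str, proj_eq_rankOne, codedVec_code]

/-- The total weight of the decompositions is controlled by the traces. -/
theorem tsum_statesOf_weights_le (U : PrefixMachine) (n : ℕ) (M : List Entry → ℕ → ℕ → GData) :
    ∑' p : List Bool, partElim (statesOf U n M p) (fun L =>
        (L.map fun r => (2⁻¹ : ℝ≥0∞) ^ (r.1 + p.length)).sum) ≤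
      4 * ∑' p : List Bool, partElim (unitRun U n p) fun Φ =>
        (2⁻¹ : ℝ≥0∞) ^ p.length * ENNReal.ofReal (dataMatrix (2 ^ n) (M Φ)).trace.re := by
  rw [← ENNReal.tsum_mul_left]
  refine ENNReal.tsum_le_tsum fun p => ?_
  rw [statesOf, partElim_bind, ← partElim_const_mul]
  refine partElim_mono fun Φ _ => ?_
  by_cases hd : (findCertificate (2 ^ n) (M Φ)).Dom
  · obtain ⟨w, hw⟩ := Part.dom_iff_mem.1 hd
    rw [partElim_map, partElim_of_mem hw]
    simp only [pow_add]
    rw [List.sum_map_mul_right]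
    refine (mul_le_mul_left (sum_weights_le_of_valid (valid_of_mem_findCertificate hw)) _).trans
      (le_of_eq ?_)
    ring
  · rw [partElim_of_not_dom (by simpa using hd)]
    exact zero_le

/-- The decompositions dominate the expectation of positive matrices. -/
theorem le_tsum_statesOf (U : PrefixMachine) {n : ℕ} {M : List Entry → ℕ → ℕ → GData}
    (hM : ∀ Φ, IsUnitCode (2 ^ (n + n)) Φ → (dataMatrix (2 ^ n) (M Φ)).PosSemidef ∧
      (dataMatrix (2 ^ n) (M Φ)).trace.re ≤ 1) {σ : QMatrix n} (hσ : σ.PosSemidef) :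
    ∑' p : List Bool, partElim (unitRun U n p) (fun Φ =>
        (2⁻¹ : ℝ≥0∞) ^ p.length * ENNReal.ofReal (σ * dataMatrix (2 ^ n) (M Φ)).trace.re) ≤
      ∑' p : List Bool, partElim (statesOf U n M p) (fun L =>
        (L.map fun r => (2⁻¹ : ℝ≥0∞) ^ (r.1 + p.length) * stateExp σ (str r.2)).sum) := by
  refine ENNReal.tsum_le_tsum fun p => ?_
  rw [statesOf, partElim_bind]
  refine partElim_mono fun Φ hΦ => ?_
  obtain ⟨h1, h2⟩ := hM Φ (isUnitCode_of_mem_unitRun hΦ)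
  have h3 : (dataMatrix (2 ^ n) (M Φ)).trace ≤ 1 :=
    Complex.le_def.2 ⟨h2, (Complex.nonneg_iff.1 h1.trace_nonneg).2.symm⟩
  obtain ⟨w₀, hw₀⟩ := exists_valid h1 h3
  obtain ⟨w, hw⟩ := Part.dom_iff_mem.1 (findCertificate_dom hw₀)
  have hv := valid_of_mem_findCertificate hw
  rw [partElim_map, partElim_of_mem hw]
  refine (mul_le_mul_right (ofReal_trace_le_of_valid hv hσ) _).trans (le_of_eq ?_)
  rw [← List.sum_map_mul_left]
  congr 1
  refine List.map_congr_left fun r hr => ?_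
  rw [stateExp_of_valid σ hv hr, pow_add]
  ring

theorem primrec_marginal : Primrec fun q : (ℕ × List Entry) × ℕ × ℕ =>
    marginal (2 ^ q.1.1) q.1.2 q.2.1 q.2.2 := by
  unfold marginal
  fun_prop

theorem primrec_weightedMarginal :
    Primrec fun q : ((((List (List Entry)) × ℕ) × ℕ) × List Entry) × ℕ × ℕ =>
      weightedMarginal (2 ^ q.1.1.2) q.1.1.1.1 q.1.2 q.2.1 q.2.2 := by
  unfold weightedMarginal
  fun_prop

/-- The total of the expectations of `ρ` in the second marginals of the produced vectors. -/
def marginalSum (U : PrefixMachine) {n : ℕ} (ρ : ElemMatrix n) : ℝ≥0∞ :=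
  ∑' p : List Bool, partElim (unitRun U n p) fun Φ => (2⁻¹ : ℝ≥0∞) ^ p.length *
    ENNReal.ofReal (ρ.toQ * dataMatrix (2 ^ n) (marginal (2 ^ n) Φ)).trace.re

theorem tsum_unitRun_le_one (U : PrefixMachine) (n : ℕ) :
    ∑' p : List Bool, partElim (unitRun U n p) (fun _ => (2⁻¹ : ℝ≥0∞) ^ p.length) ≤ 1 := by
  refine le_trans (ENNReal.tsum_le_tsum fun p => ?_)
    (U.tsum_partElim_le_one (str (([] : List Bool), n + n)))
  by_cases hd : (unitRun U n p).Dom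
  · rw [partElim, partElim, dif_pos hd, dif_pos (unitRun_dom hd)]
  · rw [partElim_of_not_dom hd]; exact zero_le

/-- Marginalization: the universal matrix on `n` qubits dominates the marginal of the universal
matrix on `2n` qubits. -/
theorem PrefixMachine.IsUniversal.marginalSum_le {U : PrefixMachine} (hU : U.IsUniversal) :
    ∃ C : ℕ, ∀ (n : ℕ) (ρ : ElemMatrix n), ρ.toQ.PosSemidef →
      marginalSum U ρ ≤ 2 ^ C * ENNReal.ofReal (universalMatrix U n [] * ρ.toQ).trace.re := by
  have hpar : Primrec fun y => (unstr (List Bool × ℕ) y).map Prod.snd :=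
    Primrec.option_map (primrec_unstr _) (Primrec.snd.comp Primrec.snd)
  -- Marginals of unit vectors have trace 1 and program weights sum to at most 1, so the
  -- decompositions weigh at most 4 = 2^2; no scaling is needed, hence h = 0.
  obtain ⟨C, hC⟩ := hU.dominates hpar (n := fun n : ℕ => n) (h := fun _ => 0) Primrec.id
    (Primrec.const 0) 2 (M := fun n Φ => marginal (2 ^ n) Φ) primrec_marginal
  refine ⟨C, fun n ρ hρ => ?_⟩
  have hy : (unstr (List Bool × ℕ) (str (([] : List Bool), n))).map Prod.snd = some n := by
    rw [unstr_str]; rfl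
  have hw := hC _ _ hy (by
    refine (tsum_statesOf_weights_le U n _).trans ?_
    rw [pow_zero, mul_one]
    have h4 : (2 : ℝ≥0∞) ^ 2 = 4 * 1 := by norm_num
    rw [h4]
    refine mul_le_mul_right (le_trans (ENNReal.tsum_le_tsum fun p => ?_)
      (tsum_unitRun_le_one U n)) _
    refine partElim_mono fun Φ hΦ => ?_
    rw [trace_marginal (isUnitCode_of_mem_unitRun hΦ)]
    simp) (stateExp ρ.toQ)
  rw [pow_zero, mul_one] at hw
  rw [(trace_universalMatrix U hρ []).2]
  refine le_trans (le_tsum_statesOf U (M := fun Φ => marginal (2 ^ n) Φ) (fun Φ hΦ => ?_) hρ) hw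
  exact ⟨posSemidef_marginal _ _, by rw [trace_marginal hΦ]; simp⟩

/-- The trace of `μ (σ ⊗ ρ)` as a sum over the programs for vectors on `2n` qubits. -/
theorem trace_tensor_le (U : PrefixMachine) {n : ℕ} {σ : QMatrix n} {ρ : ElemMatrix n}
    (hσ : σ.PosSemidef) (hρ : ρ.toQ.PosSemidef) :
    ENNReal.ofReal (universalMatrix U (n + n) [] * tensor σ ρ.toQ).trace.re ≤
      ∑' p : List Bool, partElim (unitRun U n p) (fun Φ => (2⁻¹ : ℝ≥0∞) ^ p.length *
        ENNReal.ofReal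
          (σ * dataMatrix (2 ^ n) (weightedMarginal (2 ^ n) ρ.code Φ)).trace.re) := by
  rw [(trace_universalMatrix U (posSemidef_tensor hσ hρ) []).2, U.tsum_mE_mul]
  refine ENNReal.tsum_le_tsum fun p => ?_
  by_cases hd : (U.run p (str (([] : List Bool), n + n))).Dom
  · obtain ⟨z, hz⟩ := Part.dom_iff_mem.1 hd
    rw [partElim_of_mem hz]
    -- Only codes of elementary states contribute on the left, and they all pass the test in
    -- `unitRun`. That test also admits unreduced entries, which can only enlarge the right side.
    by_cases h0 : stateExp (tensor σ ρ.toQ) z = 0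
    · rw [h0, mul_zero]; exact zero_le
    · obtain ⟨φ, rfl⟩ := exists_of_stateExp_ne_zero h0
      rw [partElim_of_mem (mem_unitRun_of_code hz), stateExp_str, trace_tensor_mul_proj]
  · rw [partElim_of_not_dom hd]; exact zero_le

/-- If the marginal sum of `ρ` is at most `2^{c - H}`, then `μ (σ ⊗ ρ)` is dominated by
`2^{-H}` times the universal matrix conditioned on `ρ` and `H`. -/
theorem PrefixMachine.IsUniversal.tensor_le {U : PrefixMachine} (hU : U.IsUniversal) (c : ℕ) :
    ∃ C : ℕ, ∀ (n : ℕ) (σ : QMatrix n) (ρ : ElemMatrix n) (H : ℕ), σ.PosSemidef →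
      IsSemiDensity ρ.toQ → 4 * marginalSum U ρ ≤ 2 ^ c * 2⁻¹ ^ H →
      ENNReal.ofReal (universalMatrix U (n + n) [] * tensor σ ρ.toQ).trace.re ≤
        2 ^ C * 2⁻¹ ^ H *
          ENNReal.ofReal (universalMatrix U n (str (ρ.code, H)) * σ).trace.re := by
  have hpar : Primrec fun y => (unstr (List Bool × ℕ) y).bind fun q =>
      (unstr (List (List Entry) × ℕ) q.1).map fun r => (r, q.2) := by
    refine Primrec.option_bind (primrec_unstr _) ?_
    refine Primrec.option_map ((primrec_unstr _).comp (Primrec.fst.comp Primrec.snd)) ?_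
    exact Primrec.pair Primrec.snd (Primrec.snd.comp (Primrec.snd.comp Primrec.fst))
  -- The condition string supplies ρ, H and n: ρ computes the matrices, and H scales their weights.
  obtain ⟨C, hC⟩ := hU.dominates hpar (n := fun a => a.2) (h := fun a => a.1.2) Primrec.snd
    (Primrec.snd.comp Primrec.fst) c
    (M := fun a Φ => weightedMarginal (2 ^ a.2) a.1.1 Φ) primrec_weightedMarginal
  refine ⟨C, fun n σ ρ H hσ hρ hle => ?_⟩
  have hy : ((unstr (List Bool × ℕ) (str (str (ρ.code, H), n))).bind fun q =>
      (unstr (List (List Entry) × ℕ) q.1).map fun r => (r, q.2)) = some ((ρ.code, H), n) := by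
    rw [unstr_str, Option.bind_some, unstr_str]; rfl
  have hw := hC _ _ hy (by
    refine (tsum_statesOf_weights_le U n _).trans (le_trans (le_of_eq ?_) hle)
    rw [marginalSum]
    simp only [trace_weightedMarginal]) (stateExp σ)
  rw [(trace_universalMatrix U hσ (str (ρ.code, H))).2]
  refine (trace_tensor_le U hσ hρ.1).trans (le_trans (le_tsum_statesOf U
    (M := fun Φ => weightedMarginal (2 ^ n) ρ.code Φ) (fun Φ hΦ => ?_) hσ) hw)
  exact ⟨posSemidef_weightedMarginal hρ.1 _, trace_weightedMarginal_re_le_one hρ hΦ⟩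

/-! ## Entropies and traces -/

theorem gacsEntropy_eq_top {U : PrefixMachine} {n : ℕ} {σ : QMatrix n} {x : List Bool}
    (h : (universalMatrix U n x * σ).trace.re = 0) : gacsEntropy U σ x = ⊤ := if_pos h

/-- Rounding the logarithm up costs at most a factor 2 in the trace. -/
theorem exists_gacsEntropy_eq {U : PrefixMachine} {n : ℕ} {σ : QMatrix n} (hσ : IsSemiDensity σ)
    {x : List Bool} (h : (universalMatrix U n x * σ).trace.re ≠ 0) :
    ∃ k : ℕ, gacsEntropy U σ x = k ∧ (1 / 2 : ℝ) ^ k ≤ (universalMatrix U n x * σ).trace.re ∧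
      (universalMatrix U n x * σ).trace.re ≤ 2 * (1 / 2) ^ k := by
  have h0 := (trace_universalMatrix U hσ.1 x).1
  have h1 := trace_universalMatrix_le_one U hσ x
  rw [gacsEntropy, if_neg h]
  generalize (universalMatrix U n x * σ).trace.re = t at *
  have hpos : 0 < t := lt_of_le_of_ne h0 (Ne.symm h)
  have hlog : 0 ≤ -Real.logb 2 t := by
    have := Real.logb_nonpos one_lt_two h0 h1
    linarith
  have ht : t = (2 : ℝ) ^ (Real.logb 2 t) := (Real.rpow_logb two_pos (by norm_num) hpos).symm
  have hk : ∀ k : ℕ, (1 / 2 : ℝ) ^ k = (2 : ℝ) ^ (-(k : ℝ)) := fun k => by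
    rw [Real.rpow_neg two_pos.le, Real.rpow_natCast, one_div, inv_pow]
  refine ⟨_, rfl, ?_, ?_⟩
  · rw [hk]
    conv_rhs => rw [ht]
    refine Real.rpow_le_rpow_of_exponent_le one_le_two ?_
    have := Nat.le_ceil (-Real.logb 2 t)
    linarith
  · rw [hk]
    conv_lhs => rw [ht]
    have h2 : (2 : ℝ) * 2 ^ (-((⌈-Real.logb 2 t⌉₊ : ℕ) : ℝ)) =
        2 ^ (1 + -((⌈-Real.logb 2 t⌉₊ : ℕ) : ℝ)) := by
      rw [Real.rpow_add two_pos, Real.rpow_one]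
    rw [h2]
    refine Real.rpow_le_rpow_of_exponent_le one_le_two ?_
    have := Nat.ceil_lt_add_one hlog
    linarith

theorem isSemiDensity_tensor {n k : ℕ} {σ : QMatrix n} {ρ : QMatrix k} (hσ : IsSemiDensity σ)
    (hρ : IsSemiDensity ρ) : IsSemiDensity (tensor σ ρ) := by
  refine ⟨posSemidef_tensor hσ.1 hρ.1, ?_⟩
  have h1 : (tensor σ ρ).trace = σ.trace * ρ.trace := by
    rw [← trace_kronecker, tensor, reindex_apply]
    exact Equiv.sum_comp _ fun p => (σ ⊗ₖ ρ) p p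
  have h2 := Complex.nonneg_iff.1 hσ.1.trace_nonneg
  have h3 := Complex.nonneg_iff.1 hρ.1.trace_nonneg
  rw [h1, Complex.mul_re, ← h2.2, zero_mul, sub_zero]
  exact mul_le_one₀ hσ.2 h3.1 hρ.2

end QAlg

end

/-! ### The addition inequality -/

theorem theorem1 (U : QAlg.PrefixMachine) (hU : U.IsUniversal) :
    ∃ c : ℕ, ∀ (n : ℕ) (σ : QAlg.QMatrix n) (ρ : QAlg.ElemMatrix n),
      QAlg.IsSemiDensity σ → QAlg.IsSemiDensity ρ.toQ →
        QAlg.gacsEntropy U ρ.toQ [] + QAlg.gacsEntropy U σ (QAlg.entropyPair U ρ)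
          ≤ QAlg.gacsEntropy U (QAlg.tensor σ ρ.toQ) [] + c := by
  obtain ⟨C₁, h₁⟩ := hU.marginalSum_le
  -- The three extra bits are the factor 4 from the decompositions and the factor 2 from rounding
  -- H(ρ).
  obtain ⟨C₂, h₂⟩ := hU.tensor_le (C₁ + 3)
  refine ⟨C₂ + 1, fun n σ ρ hσ hρ => ?_⟩
  by_cases ht : (QAlg.universalMatrix U (n + n) [] * QAlg.tensor σ ρ.toQ).trace.re = 0
  · rw [QAlg.gacsEntropy_eq_top ht, top_add]; exact le_top
  have hT := QAlg.isSemiDensity_tensor hσ hρ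
  obtain ⟨kt, ekt, lkt, -⟩ := QAlg.exists_gacsEntropy_eq hT ht
  have htpos := lt_of_le_of_ne (QAlg.trace_universalMatrix U hT.1 []).1 (Ne.symm ht)
  have key : ∀ H : ℕ, 4 * QAlg.marginalSum U ρ ≤ 2 ^ (C₁ + 3) * 2⁻¹ ^ H →
      (QAlg.universalMatrix U (n + n) [] * QAlg.tensor σ ρ.toQ).trace.re ≤ 2 ^ C₂ * (1 / 2) ^ H *
        (QAlg.universalMatrix U n (QAlg.str (ρ.code, H)) * σ).trace.re := fun H hH => by
    have h := h₂ n σ ρ H hσ.1 hρ hH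
    have h2 : (2 : ENNReal) ^ C₂ = ENNReal.ofReal (2 ^ C₂) := by
      rw [ENNReal.ofReal_pow (by norm_num)]; simp
    rw [h2, ← QAlg.ofReal_half_pow, ← ENNReal.ofReal_mul (by positivity),
      ← ENNReal.ofReal_mul (by positivity)] at h
    exact (ENNReal.ofReal_le_ofReal_iff (mul_nonneg (by positivity)
      (QAlg.trace_universalMatrix U hσ.1 _).1)).1 h
  have hm := h₁ n ρ hρ.1
  -- If H(ρ) were infinite, the marginal sum would vanish and `key` would hold for every H. The
  -- trace against σ ⊗ ρ would then be arbitrarily small, contrary to its positivity.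
  have hρ0 : (QAlg.universalMatrix U n [] * ρ.toQ).trace.re ≠ 0 := fun h0 => by
    rw [h0, ENNReal.ofReal_zero, mul_zero, nonpos_iff_eq_zero] at hm
    obtain ⟨H, hH⟩ := exists_pow_lt_of_lt_one (div_pos htpos (by positivity : (0 : ℝ) < 2 ^ C₂))
      (by norm_num : (1 / 2 : ℝ) < 1)
    have h := key H (by rw [hm, mul_zero]; exact zero_le)
    rw [lt_div_iff₀ (by positivity), mul_comm] at hH
    have h3 := QAlg.trace_universalMatrix_le_one U hσ (QAlg.str (ρ.code, H))
    exact absurd (h.trans (mul_le_of_le_one_right (by positivity) h3)) hH.not_ge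
  obtain ⟨kρ, ekρ, -, ukρ⟩ := QAlg.exists_gacsEntropy_eq hρ hρ0
  have hpair : QAlg.entropyPair U ρ = QAlg.str (ρ.code, kρ) := by
    rw [QAlg.entropyPair, ekρ, ENat.toNat_natCast]
  have h := key kρ (by
    calc 4 * QAlg.marginalSum U ρ ≤ 4 * (2 ^ C₁ * ENNReal.ofReal (2 * (1 / 2) ^ kρ)) := by
          gcongr
          exact hm.trans (by gcongr)
      _ = 2 ^ (C₁ + 3) * 2⁻¹ ^ kρ := by
          rw [ENNReal.ofReal_mul (by norm_num), QAlg.ofReal_half_pow, ENNReal.ofReal_ofNat]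
          ring)
  rw [hpair]
  have hσ0 : (QAlg.universalMatrix U n (QAlg.str (ρ.code, kρ)) * σ).trace.re ≠ 0 := fun h0 => by
    rw [h0, mul_zero] at h
    exact absurd h htpos.not_ge
  obtain ⟨kσ, ekσ, -, ukσ⟩ := QAlg.exists_gacsEntropy_eq hσ hσ0
  rw [ekt, ekρ, ekσ]
  -- Rounding the conditional entropy of σ costs the last factor 2, whence the constant C₂ + 1.
  have h4 : (1 / 2 : ℝ) ^ kt ≤ 2 ^ C₂ * (1 / 2) ^ kρ * (2 * (1 / 2) ^ kσ) :=
    lkt.trans (h.trans (mul_le_mul_of_nonneg_left ukσ (by positivity)))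
  have h5 : (1 / 2 : ℝ) ^ (kt + (C₂ + 1)) ≤ (1 / 2) ^ (kρ + kσ) := by
    have e1 : (2 : ℝ) ^ C₂ * (1 / 2) ^ C₂ = 1 := by rw [← mul_pow]; norm_num
    calc (1 / 2 : ℝ) ^ (kt + (C₂ + 1)) = (1 / 2) ^ kt * (1 / 2) ^ (C₂ + 1) := pow_add _ _ _
      _ ≤ 2 ^ C₂ * (1 / 2) ^ kρ * (2 * (1 / 2) ^ kσ) * (1 / 2) ^ (C₂ + 1) :=
          mul_le_mul_of_nonneg_right h4 (by positivity)
      _ = (2 ^ C₂ * (1 / 2) ^ C₂) * ((1 / 2) ^ kρ * (1 / 2) ^ kσ) := by ring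
      _ = (1 / 2) ^ (kρ + kσ) := by rw [e1, one_mul, pow_add]
  have h6 : kρ + kσ ≤ kt + (C₂ + 1) :=
    (pow_le_pow_iff_right_of_lt_one₀ (by norm_num) (by norm_num)).1 h5
  exact_mod_cast h6
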